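/- Let $Q$ be a smooth manifold (Hausdorff, second countable, without boundary) and let $\mathcal F$ be a smooth foliation of $Q$. Let $\Omega^p(Q)$ be the space of smooth differential $p$-forms on $Q$, let $\Omega^p(Q,\mathcal F)\subset\Omega^p(Q)$ be the subspace of forms $\omega$ with $\omega_q(v_1,\dots,v_p)=0$ for all $q\in Q$ and all vectors $v_1,\dots,v_p$ tangent to $\mathcal F$ at $q$, and put $\Omega^p(\mathcal F)=\Omega^p(Q)/\Omega^p(Q,\mathcal F)$. Since $d\,\Omega^p(Q,\mathcal F)\subset\Omega^{p+1}(Q,\mathcal F)$, the exterior derivative induces differentials $d_p:\Omega^p(\mathcal F)\to\Omega^{p+1}(\mathcal F)$; the de Rham cohomology tangent to the foliation is $H^p(\mathcal F)=\ker d_p/\operatorname{im} d_{p-1}$ (with $\operatorname{im} d_{-1}=0$). Let $S\subset Q$ be a smooth embedded submanifold transversal to $\mathcal F$, i.e. $T_qS+T_q\mathcal F=T_qQ$ for every $q\in S$, so that $\mathcal F$ induces a foliation $\mathcal F\cap S$ on $S$ with tangent spaces $T_qS\cap T_q\mathcal F$. Suppose that $Q$ is contractible to $S$ along $\mathcal F$: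 there is a family of maps $F_t:Q\to Q$, $t\in[0,1]$, and a subdivision $0=t_0<t_1<\dots<t_m=1$ such that $(t,q)\mapsto F_t(q)$ is smooth on each $[t_k,t_{k+1}]\times Q$, with $F_1=\mathrm{id}_Q$, $F_0(Q)\subset S$, $F_0|_S=\mathrm{id}_S$, and $F_t(\mathcal F_q)\subset\mathcal F_q$ for all $t\in[0,1]$ and $q\in Q$, where $\mathcal F_q$ denotes the leaf through $q$. Then for every $p\ge 0$ the real vector spaces $H^p(\mathcal F)$ and $H^p(\mathcal F\cap S)$ are isomorphic. -/

import Mathlib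

open scoped Manifold ContDiff Topology
open Set

noncomputable section
namespace LeafwiseDeRham
section Forms

variable {E : Type*} [NormedAddCommGroup E] [NormedSpace ℝ E]
  {E' : Type*} [NormedAddCommGroup E'] [NormedSpace ℝ E']
  {M : Type*} [TopologicalSpace M] [ChartedSpace E M]
  {N : Type*} [TopologicalSpace N] [ChartedSpace E' N]

variable (E M) in
/-- Families of alternating `p`-linear forms on the tangent spaces of `M` (no regularity). -/
abbrev FormField (p : ℕ) : Type _ :=
  ∀ x : M, TangentSpace 𝓘(ℝ, E) x [⋀^Fin p]→L[ℝ] ℝ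

/-- Pointwise pullback `f^* α`. -/
def pullback (f : M → N) {p : ℕ} (α : FormField E' N p) : FormField E M p :=
  fun x => (α (f x)).compContinuousLinearMap (mfderiv 𝓘(ℝ, E) 𝓘(ℝ, E') f x)

/-- The expression of `α` in the preferred chart at `x₀`: a form on the model space. -/
def chartForm {p : ℕ} (α : FormField E M p) (x₀ : M) : E → E [⋀^Fin p]→L[ℝ] ℝ :=
  pullback (chartAt E x₀).symm α

/-- A form is smooth if its expression in every preferred chart is smooth. -/
def IsSmoothForm {p : ℕ} (α : FormField E M p) : Prop :=
  ∀ x₀ : M, ContDiffOn ℝ ∞ (chartForm α x₀) (chartAt E x₀).target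

/-- The exterior derivative, computed at each point in the preferred chart. -/
def extDerivField {p : ℕ} (α : FormField E M p) : FormField E M (p + 1) :=
  fun x => (extDeriv (chartForm α x) (chartAt E x x)).compContinuousLinearMap
    (mfderiv 𝓘(ℝ, E) 𝓘(ℝ, E) (chartAt E x) x)

theorem chartForm_add {p : ℕ} (α η : FormField E M p) (x₀ : M) :
    chartForm (α + η) x₀ = chartForm α x₀ + chartForm η x₀ := rfl

theorem chartForm_smul {p : ℕ} (a : ℝ) (α : FormField E M p) (x₀ : M) :
    chartForm (a • α) x₀ = a • chartForm α x₀ := rfl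

/-- The value of a form at `x` on vectors given in the model space (every tangent space of `M` is
by definition a copy of the model space). -/
def evalAt {p : ℕ} (α : FormField E M p) (x : M) (v : Fin p → E) : ℝ := α x v

variable (E E') in
/-- The differential of `f` at `x`, as a map between the model spaces. -/
def tangentMapAt (f : M → N) (x : M) : E →L[ℝ] E' := mfderiv 𝓘(ℝ, E) 𝓘(ℝ, E') f x

theorem chartForm_apply {p : ℕ} (α : FormField E M p) (x₀ : M) (y : E) (v : Fin p → E) :
    chartForm α x₀ y v = evalAt α ((chartAt E x₀).symm y)
      (fun k => tangentMapAt E E (chartAt E x₀).symm y (v k)) := rfl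

theorem IsSmoothForm.contDiffAt {p : ℕ} {α : FormField E M p} (hα : IsSmoothForm α) (x₀ : M)
    {y : E} (hy : y ∈ (chartAt E x₀).target) : ContDiffAt ℝ ∞ (chartForm α x₀) y :=
  (hα x₀).contDiffAt ((chartAt E x₀).open_target.mem_nhds hy)

theorem two_le_smooth : minSmoothness ℝ 2 ≤ ∞ := by
  simp only [minSmoothness_of_isRCLikeNormedField]
  exact WithTop.coe_le_coe.2 le_top

variable [IsManifold 𝓘(ℝ, E) ∞ M] 

/-- `d(e⁻¹) ∘ de = id`. -/
theorem mfderiv_chart_symm_comp {x₀ : M} {w : M} (hw : w ∈ (chartAt E x₀).source) (v : E) :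
    tangentMapAt E E (chartAt E x₀).symm (chartAt E x₀ w) (tangentMapAt E E (chartAt E x₀) w v) = v := by
  have : IsManifold 𝓘(ℝ, E) 1 M := IsManifold.of_le (n := ∞) (by simp)
  have h := (mdifferentiable_chart (I := 𝓘(ℝ, E)) x₀).symm_comp_deriv hw
  exact congrArg (fun L : E →L[ℝ] E => L v) h

theorem fderiv_transition {x₀ x₁ : M} {z : E} (hz : z ∈ (chartAt E x₀).target)
    (hz' : (chartAt E x₀).symm z ∈ (chartAt E x₁).source) (v : E) :
    fderiv ℝ (fun y => chartAt E x₁ ((chartAt E x₀).symm y)) z v =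
      tangentMapAt E E (chartAt E x₁) ((chartAt E x₀).symm z)
      (tangentMapAt E E (chartAt E x₀).symm z v) := by
  have : IsManifold 𝓘(ℝ, E) 1 M := IsManifold.of_le (n := ∞) (by simp)
  have h := mfderiv_comp z ((mdifferentiable_chart (I := 𝓘(ℝ, E)) x₁).mdifferentiableAt hz')
    ((mdifferentiable_chart (I := 𝓘(ℝ, E)) x₀).mdifferentiableAt_symm hz)
  rw [mfderiv_eq_fderiv] at h
  exact congrArg (fun L : E →L[ℝ] E => L v) h

theorem chartForm_eventuallyEq {p : ℕ} (α : FormField E M p) {x₀ x₁ : M} {y : E}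
    (hy : y ∈ (chartAt E x₀).target) (hy' : (chartAt E x₀).symm y ∈ (chartAt E x₁).source) :
    chartForm α x₀ =ᶠ[𝓝 y] fun z =>
      (chartForm α x₁ (chartAt E x₁ ((chartAt E x₀).symm z))).compContinuousLinearMap
        (fderiv ℝ (fun z => chartAt E x₁ ((chartAt E x₀).symm z)) z) := by
  filter_upwards [(chartAt E x₀).open_target.mem_nhds hy,
    ((chartAt E x₀).continuousAt_symm hy).preimage_mem_nhds
      ((chartAt E x₁).open_source.mem_nhds hy')] with z hz hz'
  ext v
  rw [ContinuousAlternatingMap.compContinuousLinearMap_apply, chartForm_apply, chartForm_apply,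
    (chartAt E x₁).left_inv hz']
  congr 1
  funext k
  simp only [Function.comp_apply]
  rw [fderiv_transition hz hz', mfderiv_chart_symm_comp hz']

theorem contDiffAt_transition {x₀ x₁ : M} {y : E}
    (hy : y ∈ (chartAt E x₀).target) (hy' : (chartAt E x₀).symm y ∈ (chartAt E x₁).source) :
    ContDiffAt ℝ ∞ (fun z => chartAt E x₁ ((chartAt E x₀).symm z)) y := by
  rw [← contMDiffAt_iff_contDiffAt]
  exact ((contMDiffOn_chart (I := 𝓘(ℝ, E)) (x := x₁)).contMDiffAt
    ((chartAt E x₁).open_source.mem_nhds hy')).comp y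
    ((contMDiffOn_chart_symm (I := 𝓘(ℝ, E)) (x := x₀)).contMDiffAt
      ((chartAt E x₀).open_target.mem_nhds hy))

/-- The exterior derivative may be computed in any preferred chart. -/
theorem chartForm_extDerivField {p : ℕ} {α : FormField E M p} (hα : IsSmoothForm α) (x₀ : M)
    {y : E} (hy : y ∈ (chartAt E x₀).target) :
    chartForm (extDerivField α) x₀ y = extDeriv (chartForm α x₀) y := by
  set x := (chartAt E x₀).symm y with hx
  have hy' : (chartAt E x₀).symm y ∈ (chartAt E x).source := mem_chart_source E x
  have h := extDeriv_pullback (x := y) (r := ∞)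
    (f := fun z => chartAt E x ((chartAt E x₀).symm z))
    ((hα.contDiffAt x ((chartAt E x).map_source hy')).differentiableAt (by simp))
    (contDiffAt_transition hy hy') two_le_smooth
  rw [(chartForm_eventuallyEq α hy hy').extDeriv_eq, h]
  ext v
  rw [ContinuousAlternatingMap.compContinuousLinearMap_apply, chartForm_apply]
  change extDeriv (chartForm α x) (chartAt E x x) _ = _
  congr 1
  funext k
  simp only [Function.comp_apply]
  exact (fderiv_transition hy hy' (v k)).symm

theorem IsSmoothForm.extDerivField {p : ℕ} {α : FormField E M p} (hα : IsSmoothForm α) :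
    IsSmoothForm (extDerivField α) := by
  intro x₀
  have h : ContDiffOn ℝ ∞ (extDeriv (chartForm α x₀)) (chartAt E x₀).target :=
    (ContinuousAlternatingMap.alternatizeUncurryFinCLM ℝ E ℝ).contDiff.comp_contDiffOn
      ((hα x₀).fderiv_of_isOpen (chartAt E x₀).open_target (by simp))
  exact h.congr fun y hy => chartForm_extDerivField hα x₀ hy

theorem formField_ext_chart {p : ℕ} {α η : FormField E M p}
    (h : ∀ x : M, chartForm α x (chartAt E x x) = chartForm η x (chartAt E x x)) : α = η := by
  funext x
  refine ContinuousAlternatingMap.ext fun v => ?_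
  have := congrArg (fun L : E [⋀^Fin p]→L[ℝ] ℝ =>
    L (fun k => tangentMapAt E E (chartAt E x) x (v k))) (h x)
  have hv : (fun k => tangentMapAt E E (chartAt E x).symm (chartAt E x x)
      (tangentMapAt E E (chartAt E x) x (v k))) = v :=
    funext fun k => mfderiv_chart_symm_comp (mem_chart_source E x) (v k)
  simp only [chartForm_apply] at this
  rw [(chartAt E x).left_inv (mem_chart_source E x), hv] at this
  exact this

theorem extDerivField_extDerivField {p : ℕ} {α : FormField E M p} (hα : IsSmoothForm α) :
    extDerivField (extDerivField α) = 0 := by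
  refine formField_ext_chart fun x => ?_
  have hx := mem_chart_target E x
  rw [chartForm_extDerivField hα.extDerivField x hx]
  have h : chartForm (extDerivField α) x =ᶠ[𝓝 (chartAt E x x)] extDeriv (chartForm α x) := by
    filter_upwards [(chartAt E x).open_target.mem_nhds hx] with y hy
    exact chartForm_extDerivField hα x hy
  rw [h.extDeriv_eq, extDeriv_extDeriv_apply (hα.contDiffAt x hx) two_le_smooth]
  rfl

variable (E M) in
/-- `Ω^p(M)`: the real vector space of smooth `p`-forms. -/
def DiffForm (p : ℕ) : Submodule ℝ (FormField E M p) where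
  carrier := {α | IsSmoothForm α}
  add_mem' {a b} ha hb x₀ := by rw [chartForm_add]; exact (ha x₀).add (hb x₀)
  zero_mem' x₀ := contDiffOn_const (c := (0 : E [⋀^Fin p]→L[ℝ] ℝ))
  smul_mem' a b hb x₀ := by rw [chartForm_smul]; exact contDiffOn_const.smul (hb x₀)

instance (p : ℕ) : AddCommGroup (DiffForm E M p) := Submodule.addCommGroup _

/-- The exterior derivative `d : Ω^p(M) → Ω^{p+1}(M)`. -/
def DiffForm.d (p : ℕ) : DiffForm E M p →ₗ[ℝ] DiffForm E M (p + 1) where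
  toFun α := ⟨extDerivField α.1, α.2.extDerivField⟩
  map_add' a b := by
    refine Subtype.ext (funext fun x => ?_)
    change ContinuousAlternatingMap.compContinuousLinearMap
      (extDeriv (chartForm a.1 x + chartForm b.1 x) (chartAt E x x)) _ = _
    rw [extDeriv_add ((a.2.contDiffAt x (mem_chart_target E x)).differentiableAt (by simp))
      ((b.2.contDiffAt x (mem_chart_target E x)).differentiableAt (by simp))]
    rfl
  map_smul' c a := by
    refine Subtype.ext (funext fun x => ?_)
    change ContinuousAlternatingMap.compContinuousLinearMap
      (extDeriv (c • chartForm a.1 x) (chartAt E x x)) _ = _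
    rw [extDeriv_smul]
    rfl

theorem DiffForm.d_d (p : ℕ) (α : DiffForm E M p) : d (p + 1) (d p α) = 0 :=
  Subtype.ext (extDerivField_extDerivField α.2)

end Forms

section Foliations

variable {E : Type*} [NormedAddCommGroup E] [NormedSpace ℝ E]
  {E' : Type*} [NormedAddCommGroup E'] [NormedSpace ℝ E']
  {M : Type*} [TopologicalSpace M] [ChartedSpace E M]
  {N : Type*} [TopologicalSpace N] [ChartedSpace E' N]
  {c : ℕ}

variable (E M) in
/-- A smooth foliation of codimension `c` on `M`, given by a Haefliger cocycle: an open cover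
`(U_i)` of `M` and smooth submersions `s_i : U_i → ℝ^c` such that, near each point of `U_i ∩ U_j`,
`s_i = γ ∘ s_j` for a smooth local map `γ` of `ℝ^c`. (Exchanging `i` and `j` shows that `γ` is a
local diffeomorphism.) The plaques are the connected components of the fibres of the `s_i`. -/
structure Foliation (c : ℕ) where
  /-- The index set of the cover. -/
  Index : Type*
  /-- The open sets `U_i`. -/
  dom : Index → Set M
  isOpen_dom : ∀ i, IsOpen (dom i)
  exists_mem_dom : ∀ x, ∃ i, x ∈ dom i
  /-- The submersions `s_i` (only their values on `U_i` matter). -/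
  proj : Index → M → EuclideanSpace ℝ (Fin c)
  contMDiffOn_proj : ∀ i, ContMDiffOn 𝓘(ℝ, E) (𝓡 c) ∞ (proj i) (dom i)
  surjective_mfderiv : ∀ i, ∀ x ∈ dom i,
    Function.Surjective (mfderiv 𝓘(ℝ, E) (𝓡 c) (proj i) x)
  exists_transition : ∀ i j, ∀ x ∈ dom i ∩ dom j,
    ∃ γ : EuclideanSpace ℝ (Fin c) → EuclideanSpace ℝ (Fin c),
      ContDiffAt ℝ ∞ γ (proj j x) ∧ proj i =ᶠ[𝓝 x] γ ∘ proj j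

variable (E) in
/-- A family `Φ_t : M → M`, `t ∈ [0,1]`, is piecewise smooth if `[0,1]` has a finite subdivision
such that `(t, x) ↦ Φ_t x` is smooth on each `[t_k, t_{k+1}] × M`. -/
def IsPiecewiseSmoothFamily (Φ : ℝ → M → M) : Prop :=
  ∃ (m : ℕ) (t : ℕ → ℝ), t 0 = 0 ∧ t m = 1 ∧ ∀ k < m, t k < t (k + 1) ∧
    ContMDiffOn (𝓘(ℝ, ℝ).prod 𝓘(ℝ, E)) 𝓘(ℝ, E) ∞ (fun z : ℝ × M => Φ z.1 z.2)
      (Icc (t k) (t (k + 1)) ×ˢ univ)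

namespace Foliation

variable (F : Foliation E M c)

/-- The leaf topology: it is generated by the intersections of the open sets of `M` with the
fibres of the local submersions. -/
abbrev leafTopology : TopologicalSpace M :=
  TopologicalSpace.generateFrom
    {W | ∃ (V : Set M) (i : F.Index) (a : EuclideanSpace ℝ (Fin c)),
      IsOpen V ∧ W = V ∩ {x | x ∈ F.dom i ∧ F.proj i x = a}}

/-- The leaf through `q`: the connected component of `q` for the leaf topology. -/
def leaf (q : M) : Set M := @connectedComponent M F.leafTopology q

/-- `M` is contractible to `S` along the foliation. -/
def IsContractibleAlong (S : Set M) : Prop :=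
  ∃ Φ : ℝ → M → M, IsPiecewiseSmoothFamily E Φ ∧
    (∀ q, Φ 1 q = q) ∧ (∀ q, Φ 0 q ∈ S) ∧ (∀ q ∈ S, Φ 0 q = q) ∧
    ∀ t ∈ Icc (0 : ℝ) 1, ∀ q, MapsTo (Φ t) (F.leaf q) (F.leaf q)

/-- The space of vectors tangent to the foliation at `x`, i.e. the kernel of `ds_i` at `x` for
every `i` with `x ∈ U_i` (all these kernels coincide). -/
def tangentSpace (x : M) : Submodule ℝ (TangentSpace 𝓘(ℝ, E) x) where
  carrier := {v | ∀ i, x ∈ F.dom i → mfderiv 𝓘(ℝ, E) (𝓡 c) (F.proj i) x v = 0}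
  add_mem' ha hb i hi := by rw [map_add, ha i hi, hb i hi, add_zero]
  zero_mem' i hi := map_zero _
  smul_mem' r v hv i hi := by rw [map_smul, hv i hi, smul_zero]

theorem mdifferentiableAt_proj (i : F.Index) {x : M} (hx : x ∈ F.dom i) :
    MDifferentiableAt 𝓘(ℝ, E) (𝓡 c) (F.proj i) x :=
  ((F.contMDiffOn_proj i).contMDiffAt ((F.isOpen_dom i).mem_nhds hx)).mdifferentiableAt (by simp)

/-- The kernel of `ds_i` at `x` does not depend on `i`. -/
theorem mem_tangentSpace_iff {i : F.Index} {x : M} (hx : x ∈ F.dom i)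
    (v : TangentSpace 𝓘(ℝ, E) x) :
    v ∈ F.tangentSpace x ↔ mfderiv 𝓘(ℝ, E) (𝓡 c) (F.proj i) x v = 0 := by
  refine ⟨fun h => h i hx, fun h j hj => ?_⟩
  obtain ⟨γ, hγ, heq⟩ := F.exists_transition j i x ⟨hj, hx⟩
  rw [heq.mfderiv_eq, mfderiv_comp x (hγ.differentiableAt (by simp)).mdifferentiableAt
    (F.mdifferentiableAt_proj i hx)]
  change (mfderiv (𝓡 c) (𝓡 c) γ (F.proj i x)) (mfderiv 𝓘(ℝ, E) (𝓡 c) (F.proj i) x v) = 0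
  rw [h, map_zero]

variable (E') in
/-- A map `f` into `M` is transverse to the foliation if the image of its differential and the
tangent space of the foliation span the tangent space of `M`. -/
def IsTransverse (f : N → M) : Prop :=
  ∀ y : N, (mfderiv 𝓘(ℝ, E') 𝓘(ℝ, E) f y).range ⊔ F.tangentSpace (f y) = ⊤

/-- The foliation induced on `N` by a smooth map `f : N → M` transverse to the foliation: its
distinguished submersions are the `s_i ∘ f`, so its plaques are the components of the preimages
of plaques. For the inclusion of a submanifold `S` it is the foliation `F ∩ S`. -/
def induced (f : N → M) (hf : ContMDiff 𝓘(ℝ, E') 𝓘(ℝ, E) ∞ f) (hT : F.IsTransverse E' f) :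
    Foliation E' N c where
  Index := F.Index
  dom i := f ⁻¹' F.dom i
  isOpen_dom i := (F.isOpen_dom i).preimage hf.continuous
  exists_mem_dom y := F.exists_mem_dom (f y)
  proj i := F.proj i ∘ f
  contMDiffOn_proj i := (F.contMDiffOn_proj i).comp hf.contMDiffOn fun _ h => h
  surjective_mfderiv i y hy w := by
    obtain ⟨v, hv⟩ := F.surjective_mfderiv i (f y) hy w
    have hv' : v ∈ (mfderiv 𝓘(ℝ, E') 𝓘(ℝ, E) f y).range ⊔ F.tangentSpace (f y) := by
      rw [hT y]; trivial
    obtain ⟨a, ⟨u, rfl⟩, b, hb, rfl⟩ := Submodule.mem_sup.1 hv'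
    refine ⟨u, ?_⟩
    rw [mfderiv_comp y (F.mdifferentiableAt_proj i hy) (hf.mdifferentiable (by simp) y)]
    rw [map_add, hb i hy, add_zero] at hv
    exact hv
  exists_transition i j y hy := by
    obtain ⟨γ, hγ, heq⟩ := F.exists_transition i j (f y) hy
    exact ⟨γ, hγ, heq.comp_tendsto hf.continuous.continuousAt⟩

/-- `Ω^p(M, F)`: the smooth `p`-forms that vanish on all `p`-tuples of vectors tangent to the
foliation. -/
def vanishingForms [IsManifold 𝓘(ℝ, E) ∞ M] (p : ℕ) : Submodule ℝ (DiffForm E M p) where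
  carrier := {α | ∀ (x : M) (v : Fin p → TangentSpace 𝓘(ℝ, E) x),
    (∀ k, v k ∈ F.tangentSpace x) → α.1 x v = 0}
  add_mem' {a b} ha hb x v hv := by
    change a.1 x v + b.1 x v = 0
    rw [ha x v hv, hb x v hv, add_zero]
  zero_mem' x v hv := rfl
  smul_mem' r a ha x v hv := by
    change r • a.1 x v = 0
    rw [ha x v hv, smul_zero]

/-- Local parametrization of the fibres of a submersion. -/
theorem exists_fibre_param [FiniteDimensional ℝ E] {s : E → EuclideanSpace ℝ (Fin c)} {y : E}
    (hs : ContDiffAt ℝ ∞ s y) (hsurj : Function.Surjective (fderiv ℝ s y)) :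
    ∃ g : (fderiv ℝ s y).ker → E, g 0 = y ∧ ContDiffAt ℝ ∞ g 0 ∧
      (∀ u, fderiv ℝ g 0 u = u) ∧ ∀ᶠ k in 𝓝 0, s (g k) = s y := by
  have hc : CompleteSpace E := FiniteDimensional.complete ℝ E
  have hst : HasStrictFDerivAt s (fderiv ℝ s y) y := hs.hasStrictFDerivAt (by simp)
  have hr : (fderiv ℝ s y).range = ⊤ := LinearMap.range_eq_top.2 hsurj
  refine ⟨hst.implicitFunction s _ hr (s y), hst.implicitFunction_apply_image hr, ?_, fun u => ?_,
    ?_⟩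
  · let φ := HasStrictFDerivAt.implicitFunctionDataOfComplemented s _ hst hr
      (fderiv ℝ s y).ker_closedComplemented_of_finiteDimensional_range
    have h : ContDiffAt ℝ ∞ φ.implicitFunction.uncurry (φ.prodFun φ.pt) := by
      refine ImplicitFunctionData.contDiffAt_implicitFunction hs ?_ (by simp)
      exact φ.rightDeriv.contDiff.contDiffAt.comp y (contDiffAt_id.sub contDiffAt_const)
    have h0 : φ.prodFun φ.pt = (s y, 0) := by
      simp [φ, ImplicitFunctionData.prodFun]
    rw [h0] at h
    exact h.comp (0 : (fderiv ℝ s y).ker) (contDiffAt_const.prodMk contDiffAt_id)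
  · rw [(hst.to_implicitFunction hr).hasFDerivAt.fderiv]; rfl
  · have h := hst.map_implicitFunction_eq hr
    have ht : Filter.Tendsto (fun k : (fderiv ℝ s y).ker => (s y, k)) (𝓝 0) (𝓝 (s y, 0)) :=
      (Continuous.prodMk_right (s y)).tendsto 0
    exact ht.eventually h

variable [IsManifold 𝓘(ℝ, E) ∞ M]

/-- `d Ω^p(M, F) ⊆ Ω^{p+1}(M, F)`. -/
theorem d_mem_vanishingForms [FiniteDimensional ℝ E] {p : ℕ} {α : DiffForm E M p}
    (hα : α ∈ F.vanishingForms p) : DiffForm.d p α ∈ F.vanishingForms (p + 1) := by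
  intro x v hv
  obtain ⟨i, hi⟩ := F.exists_mem_dom x
  set e := chartAt E x with he
  have hxs : x ∈ e.source := mem_chart_source E x
  have hxt : e x ∈ e.target := mem_chart_target E x
  have hM : IsManifold 𝓘(ℝ, E) 1 M := IsManifold.of_le (n := ∞) (by simp)
  set s : E → EuclideanSpace ℝ (Fin c) := fun y => F.proj i (e.symm y) with hsdef
  have hnear : ∀ᶠ y in 𝓝 (e x), y ∈ e.target ∧ e.symm y ∈ F.dom i :=
    Filter.Eventually.and (e.open_target.mem_nhds hxt)
      ((e.continuousAt_symm hxt).preimage_mem_nhds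
        ((F.isOpen_dom i).mem_nhds (by rw [e.left_inv hxs]; exact hi)))
  have hs : ∀ y, y ∈ e.target → e.symm y ∈ F.dom i → ContDiffAt ℝ ∞ s y := fun y hy hy' => by
    rw [← contMDiffAt_iff_contDiffAt]
    exact ((F.contMDiffOn_proj i).contMDiffAt ((F.isOpen_dom i).mem_nhds hy')).comp y
      ((contMDiffOn_chart_symm (I := 𝓘(ℝ, E)) (x := x)).contMDiffAt (e.open_target.mem_nhds hy))
  have hds : ∀ y, y ∈ e.target → e.symm y ∈ F.dom i → ∀ u : E,
      fderiv ℝ s y u = tangentMapAt E (EuclideanSpace ℝ (Fin c)) (F.proj i) (e.symm y)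
        (tangentMapAt E E e.symm y u) := fun y hy hy' u => by
    have h := mfderiv_comp y (F.mdifferentiableAt_proj i hy')
      ((mdifferentiable_chart (I := 𝓘(ℝ, E)) x).mdifferentiableAt_symm hy)
    rw [mfderiv_eq_fderiv] at h
    exact congrArg (fun L : E →L[ℝ] EuclideanSpace ℝ (Fin c) => L u) h
  have hx' : e.symm (e x) ∈ F.dom i := hnear.self_of_nhds.2
  have hds0 : ∀ u : E, fderiv ℝ s (e x) (tangentMapAt E E e x u) =
      tangentMapAt E (EuclideanSpace ℝ (Fin c)) (F.proj i) x u := fun u => by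
    rw [hds _ hxt hx', e.left_inv hxs, mfderiv_chart_symm_comp hxs]
  have hsurj : Function.Surjective (fderiv ℝ s (e x)) := by
    intro w
    obtain ⟨u, hu⟩ := F.surjective_mfderiv i x hi w
    exact ⟨tangentMapAt E E e x u, (hds0 u).trans hu⟩
  obtain ⟨g, hg0, hg, hdg, hgs⟩ := exists_fibre_param (hs _ hxt hx') hsurj
  have hpull : (fun k => (chartForm α.1 x (g k)).compContinuousLinearMap (fderiv ℝ g k))
      =ᶠ[𝓝 0] fun _ => 0 := by
    have hgc : Filter.Tendsto g (𝓝 0) (𝓝 (e x)) := by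
      have h := hg.continuousAt.tendsto
      rwa [hg0] at h
    have hgd : ∀ᶠ k in 𝓝 0, DifferentiableAt ℝ g k :=
      ((hg.of_le (m := 1) (by simp)).eventually (by simp)).mono
        fun k hk => hk.differentiableAt (by simp)
    filter_upwards [hgc.eventually hnear, hgs.eventually_nhds, hgd] with k hk hsk hdk
    ext w
    rw [ContinuousAlternatingMap.compContinuousLinearMap_apply, chartForm_apply]
    refine hα _ _ fun l => (F.mem_tangentSpace_iff hk.2 _).2 ?_
    have h1 : fderiv ℝ (s ∘ g) k (w l) = 0 := by
      have : s ∘ g =ᶠ[𝓝 k] fun _ => s (e x) := hsk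
      rw [this.fderiv_eq]; simp
    rw [fderiv_comp k ((hs _ hk.1 hk.2).differentiableAt (by simp)) hdk] at h1
    rw [ContinuousLinearMap.comp_apply, hds _ hk.1 hk.2] at h1
    exact h1
  have hker : ∀ l, tangentMapAt E E e x (v l) ∈ (fderiv ℝ s (e x)).ker := fun l => by
    exact LinearMap.mem_ker.2 ((hds0 (v l)).trans (hv l i hi))
  have hext := extDeriv_pullback (x := 0) (r := ∞) (f := g)
    ((α.2.contDiffAt x (by rw [hg0]; exact hxt)).differentiableAt (by simp)) hg two_le_smooth
  rw [hpull.extDeriv_eq] at hext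
  have hfin := congrArg (fun L : (fderiv ℝ s (e x)).ker [⋀^Fin (p + 1)]→L[ℝ] ℝ =>
    L fun l => ⟨tangentMapAt E E e x (v l), hker l⟩) hext
  simp only [ContinuousAlternatingMap.compContinuousLinearMap_apply, hg0] at hfin
  have hz : extDeriv (fun _ : (fderiv ℝ s (e x)).ker =>
      (0 : (fderiv ℝ s (e x)).ker [⋀^Fin p]→L[ℝ] ℝ)) 0 = 0 := by
    rw [extDeriv, fderiv_fun_const]
    exact map_zero (ContinuousAlternatingMap.alternatizeUncurryFinCLM ℝ _ ℝ)
  rw [hz] at hfin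
  change extDeriv (chartForm α.1 x) (e x) (fun l => tangentMapAt E E e x (v l)) = 0
  refine Eq.trans ?_ hfin.symm
  congr 1
  funext l
  exact (hdg ⟨tangentMapAt E E e x (v l), hker l⟩).symm

variable [FiniteDimensional ℝ E]

/-- `Ω^p(F) = Ω^p(M) / Ω^p(M, F)`. -/
abbrev LeafForm (p : ℕ) : Type _ := DiffForm E M p ⧸ F.vanishingForms p

/-- The differential `d_p : Ω^p(F) → Ω^{p+1}(F)` induced by the exterior derivative. -/
def leafD (p : ℕ) : F.LeafForm p →ₗ[ℝ] F.LeafForm (p + 1) :=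
  Submodule.mapQ _ _ (DiffForm.d p) fun _ h => F.d_mem_vanishingForms h

theorem leafD_leafD (p : ℕ) : F.leafD (p + 1) ∘ₗ F.leafD p = 0 := by
  ext a
  change Submodule.Quotient.mk (DiffForm.d (p + 1) (DiffForm.d p a)) = 0
  rw [DiffForm.d_d]; rfl

/-- The complex `Ω^0(F) → Ω^1(F) → Ω^2(F) → ⋯`. -/
def leafComplex : CochainComplex (ModuleCat ℝ) ℕ :=
  CochainComplex.of (fun p => ModuleCat.of ℝ (F.LeafForm p)) (fun p => ModuleCat.ofHom (F.leafD p))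
    fun p => by rw [← ModuleCat.ofHom_comp, leafD_leafD]; rfl

/-- `H^p(F) = ker d_p / im d_{p-1}`: the de Rham cohomology tangent to the foliation. -/
def cohomology (p : ℕ) : ModuleCat ℝ := F.leafComplex.homology p

end Foliation
end Foliations
end LeafwiseDeRham

end

/-! Let i be the inclusion of `S`, and let r : Q → S be Φ_0 with its target restricted. Then r ∘ i
is the identity, while i ∘ r = Φ_0 is joined to Φ_1 = id by the given family. So i^* and r^* are
mutually inverse on H^p as soon as Φ_0 and Φ_1 induce the same endomorphism of H^p(F).

For a homotopy Ψ smooth in (t, x), the operator K α = ∫₀¹ Ψ_t^*(ι_{∂Ψ/∂t} α) dt satisfies dK + Kd =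
Ψ_1^* - Ψ_0^* (`extDerivField_homotopyOperator_add`). It descends to forms along the leaves once it
sends vanishing forms to vanishing forms. This happens when the differentials of the Ψ_t preserve
vectors tangent to the leaves and the velocities ∂Ψ/∂t are tangent to the leaves
(`homotopyForm_mem`).

The hypothesis, however, only says that Φ_t maps each leaf into itself as a set. The infinitesimal
statement comes from second countability: a leaf meets the domain of a distinguished submersion in
countably many fibres (`countable_image_leaf`). Along a curve contained in a leaf and continuous for
the topology of the manifold, the submersion therefore has a countable connected image, so it is
constant and the velocity lies in its kernel (`tangentMapAt_mem_tangentSpace`). Conversely, every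
tangent vector is the velocity of a curve in the leaf (`exists_curve_mem_leaf`), which controls the
differentials of the Φ_t.

Each smooth piece of Φ is reparametrized to a homotopy defined for all real times, and the
equalities in cohomology are chained over the subdivision. -/

set_option maxSynthPendingDepth 3

noncomputable section
namespace LeafwiseDeRham

/-! ### Alternating forms on `E` and on `ℝ × E`: smoothness and contraction with ∂/∂t -/

section AlternatingCalculus

variable {E : Type*} [NormedAddCommGroup E] [NormedSpace ℝ E]
  {V : Type*} [NormedAddCommGroup V] [NormedSpace ℝ V]
  {W : Type*} [NormedAddCommGroup W] [NormedSpace ℝ W]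

/-- On a finite-dimensional space, the smoothness of a family of alternating forms may be tested
on the values of the forms. -/
theorem contDiffOn_alternating_of_apply [FiniteDimensional ℝ E] {p : ℕ} {n : ℕ∞ω}
    {f : V → E [⋀^Fin p]→L[ℝ] ℝ} {s : Set V}
    (h : ∀ v, ContDiffOn ℝ n (fun z => f z v) s) : ContDiffOn ℝ n f s := by
  let b := Module.finBasis ℝ E
  let ev : (E [⋀^Fin p]→L[ℝ] ℝ) →ₗ[ℝ] ((Fin p → Fin (Module.finrank ℝ E)) → ℝ) :=
    { toFun := fun a i => a fun k => b (i k)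
      map_add' := fun _ _ => rfl
      map_smul' := fun _ _ => rfl }
  have hev : Function.Injective ev := fun a a' haa' =>
    ContinuousAlternatingMap.toAlternatingMap_injective
      (Module.Basis.ext_alternating b fun i _ => congrFun haa' i)
  -- The left inverse starts from a finite-dimensional space, so it is continuous: `f` is a
  -- continuous linear function of finitely many of its values.
  obtain ⟨g, hg⟩ := ev.exists_leftInverse_of_injective (LinearMap.ker_eq_bot.2 hev)
  have hgf : f = fun z => LinearMap.toContinuousLinearMap g (ev (f z)) :=
    funext fun z => (congrArg (fun L => L (f z)) hg).symm
  rw [hgf]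
  exact (ContinuousLinearMap.contDiff _).comp_contDiffOn (contDiffOn_pi.2 fun i => h _)

/-- The composite is linear in the form and multilinear in `p` copies of the linear map. Testing on
fixed vectors transfers the question to multilinear maps, where this dependence is a continuous
multilinear operation. -/
theorem contDiffOn_compContinuousLinearMap [FiniteDimensional ℝ E] {p : ℕ} {n : ℕ∞ω}
    {f : V → W [⋀^Fin p]→L[ℝ] ℝ} {g : V → E →L[ℝ] W} {s : Set V}
    (hf : ContDiffOn ℝ n f s) (hg : ContDiffOn ℝ n g s) :
    ContDiffOn ℝ n (fun z => (f z).compContinuousLinearMap (g z)) s := by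
  refine contDiffOn_alternating_of_apply fun v => ?_
  have h1 : ContDiffOn ℝ n (fun z =>
      ContinuousMultilinearMap.compContinuousLinearMapContinuousMultilinear ℝ
        (fun _ : Fin p => E) (fun _ : Fin p => W) ℝ (fun _ => g z)) s :=
    (ContinuousMultilinearMap.contDiff _).comp_contDiffOn (contDiffOn_pi.2 fun _ => hg)
  have h2 : ContDiffOn ℝ n (fun z => (f z).toContinuousMultilinearMap) s :=
    (ContinuousAlternatingMap.toContinuousMultilinearMapLI (𝕜 := ℝ) (E := W) (F := ℝ)
        (ι := Fin p)).toContinuousLinearMap.contDiff.comp_contDiffOn hf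
  exact (ContinuousMultilinearMap.apply ℝ (fun _ : Fin p => E) ℝ v).contDiff.comp_contDiffOn
    (h1.clm_apply h2)

variable (E) in
/-- The form on `E` obtained from a form on `ℝ × E` by contraction with the unit vector of `ℝ`. -/
def contractTime (p : ℕ) : ((ℝ × E) [⋀^Fin (p + 1)]→L[ℝ] ℝ) →L[ℝ] E [⋀^Fin p]→L[ℝ] ℝ :=
  (ContinuousAlternatingMap.compContinuousLinearMapCLM (ContinuousLinearMap.inr ℝ ℝ E)).comp
    ((ContinuousLinearMap.apply ℝ _ ((1 : ℝ), (0 : E))).comp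
      (ContinuousAlternatingMap.curryLeftLI (𝕜 := ℝ)).toContinuousLinearMap)

variable (E) in
/-- The restriction of forms on `ℝ × E` to `E`. -/
def restrictSpace (p : ℕ) : ((ℝ × E) [⋀^Fin p]→L[ℝ] ℝ) →L[ℝ] E [⋀^Fin p]→L[ℝ] ℝ :=
  ContinuousAlternatingMap.compContinuousLinearMapCLM (ContinuousLinearMap.inr ℝ ℝ E)

theorem contractTime_apply {p : ℕ} (β : (ℝ × E) [⋀^Fin (p + 1)]→L[ℝ] ℝ) (v : Fin p → E) :
    contractTime E p β v =
      β (Fin.cons ((1 : ℝ), (0 : E)) fun k => ((0 : ℝ), v k)) := rfl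

theorem restrictSpace_apply {p : ℕ} (β : (ℝ × E) [⋀^Fin p]→L[ℝ] ℝ) (v : Fin p → E) :
    restrictSpace E p β v = β fun k => ((0 : ℝ), v k) := rfl

/-- Cartan's formula in degree 0, where the term d ι_{∂/∂t} is absent. -/
theorem contractTime_alternatizeUncurryFin_zero
    (D : ℝ × E →L[ℝ] (ℝ × E) [⋀^Fin 0]→L[ℝ] ℝ) :
    contractTime E 0 (ContinuousAlternatingMap.alternatizeUncurryFin D) =
      restrictSpace E 0 (D (1, 0)) := by
  ext v
  rw [contractTime_apply, ContinuousAlternatingMap.alternatizeUncurryFin_apply, restrictSpace_apply]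
  simp only [Fin.sum_univ_succ, Fin.sum_univ_zero, Fin.cons_zero, Fin.val_zero, pow_zero, one_smul,
    add_zero]
  congr 1

/-- Cartan's formula ι d = L - d ι for ∂/∂t, as linear algebra on the derivative `D` of a form. In
the alternating sum with ∂/∂t inserted first, the summand of index 0 differentiates along ∂/∂t.
Every other summand keeps ∂/∂t in the first slot, and the index shift costs one sign. -/
theorem contractTime_alternatizeUncurryFin_succ {p : ℕ}
    (D : ℝ × E →L[ℝ] (ℝ × E) [⋀^Fin (p + 1)]→L[ℝ] ℝ) :
    contractTime E (p + 1) (ContinuousAlternatingMap.alternatizeUncurryFin D) =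
      restrictSpace E (p + 1) (D (1, 0)) -
        ContinuousAlternatingMap.alternatizeUncurryFin
          ((contractTime E p).comp (D.comp (ContinuousLinearMap.inr ℝ ℝ E))) := by
  ext v
  rw [contractTime_apply, ContinuousAlternatingMap.alternatizeUncurryFin_apply,
    ContinuousAlternatingMap.sub_apply, restrictSpace_apply,
    ContinuousAlternatingMap.alternatizeUncurryFin_apply, Fin.sum_univ_succ, sub_eq_add_neg,
    ← Finset.sum_neg_distrib]
  congr 1
  · simp only [Fin.cons_zero, Fin.val_zero, pow_zero, one_smul, Fin.removeNth_zero, Fin.tail_cons]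
  · refine Finset.sum_congr rfl fun i _ => ?_
    have hw : i.succ.removeNth (α := fun _ => ℝ × E)
        (Fin.cons ((1 : ℝ), (0 : E)) fun k => ((0 : ℝ), v k)) =
        Fin.cons ((1 : ℝ), (0 : E)) fun k => ((0 : ℝ), i.removeNth v k) := by
      funext k
      refine Fin.cases ?_ (fun k => ?_) k
      · simp [Fin.removeNth_apply]
      · simp [Fin.removeNth_apply]
    rw [hw, Fin.cons_succ, Fin.val_succ, pow_succ, mul_neg_one, neg_smul]
    rfl

end AlternatingCalculus

/-! ### Differentiation under the integral sign -/

section ParametricIntegral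

variable {E : Type*} [NormedAddCommGroup E] [NormedSpace ℝ E] [FiniteDimensional ℝ E]
  {F : Type*} [NormedAddCommGroup F] [NormedSpace ℝ F]

theorem continuous_time_slice {X Y : Type*} [TopologicalSpace X] [TopologicalSpace Y]
    {f : ℝ × X → Y} {U : Set X} (hf : ContinuousOn f (univ ×ˢ U)) {y : X} (hy : y ∈ U) :
    Continuous fun t => f (t, y) :=
  hf.comp_continuous (Continuous.prodMk_left y) fun t => ⟨mem_univ t, hy⟩

/-- The partial derivative is continuous, hence bounded on the compact product of `[0,1]` with a
small closed ball, and a constant dominates. -/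
theorem hasFDerivAt_intervalIntegral_slice {f : ℝ × E → F} {U : Set E} (hU : IsOpen U)
    (hf : ContDiffOn ℝ 1 f (univ ×ˢ U)) {y₀ : E} (hy₀ : y₀ ∈ U) :
    HasFDerivAt (fun y => ∫ t in (0 : ℝ)..1, f (t, y))
      (∫ t in (0 : ℝ)..1, (fderiv ℝ f (t, y₀)).comp (ContinuousLinearMap.inr ℝ ℝ E)) y₀ := by
  have : ProperSpace E := FiniteDimensional.proper_real E
  have hUo : IsOpen ((univ : Set ℝ) ×ˢ U) := isOpen_univ.prod hU
  obtain ⟨r, hr, hrU⟩ := Metric.nhds_basis_closedBall.mem_iff.1 (hU.mem_nhds hy₀)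
  set F' : E → ℝ → E →L[ℝ] F := fun y t =>
    (fderiv ℝ f (t, y)).comp (ContinuousLinearMap.inr ℝ ℝ E) with hF'
  have hcont : ContinuousOn (fun z : ℝ × E => F' z.2 z.1) (univ ×ˢ U) :=
    (hf.continuousOn_fderiv_of_isOpen hUo le_rfl).clm_comp continuousOn_const
  obtain ⟨C, hC⟩ := (isCompact_Icc (a := (0 : ℝ)) (b := 1)).prod
    (isCompact_closedBall y₀ r) |>.exists_bound_of_continuousOn
      (hcont.mono (prod_mono (subset_univ _) hrU))
  refine intervalIntegral.hasFDerivAt_integral_of_dominated_of_fderiv_le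
    (F := fun y t => f (t, y)) (F' := F') (bound := fun _ => C)
    (Metric.closedBall_mem_nhds y₀ hr) ?_ ?_ ?_ ?_ ?_ ?_
  · filter_upwards [hU.mem_nhds hy₀] with y hy
    exact (continuous_time_slice hf.continuousOn hy).aestronglyMeasurable
  · exact (continuous_time_slice hf.continuousOn hy₀).intervalIntegrable _ _
  · exact (continuous_time_slice hcont hy₀).aestronglyMeasurable
  · refine Filter.Eventually.of_forall fun t ht y hy => hC (t, y) ⟨?_, hy⟩
    rw [uIoc_of_le zero_le_one] at ht
    exact ⟨ht.1.le, ht.2⟩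
  · exact intervalIntegrable_const
  · refine Filter.Eventually.of_forall fun t _ y hy => ?_
    have h : HasFDerivAt f (fderiv ℝ f (t, y)) (t, y) :=
      ((hf.contDiffAt (hUo.mem_nhds ⟨mem_univ t, hrU hy⟩)).differentiableAt
        (by simp)).hasFDerivAt
    exact h.comp y (hasFDerivAt_prodMk_right t y)

end ParametricIntegral

/-- Integrals over `[0,1]` depend smoothly on parameters. -/
theorem contDiffOn_intervalIntegral_slice.{u} {E F : Type u} [NormedAddCommGroup E]
    [NormedSpace ℝ E] [FiniteDimensional ℝ E] [NormedAddCommGroup F] [NormedSpace ℝ F]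
    {f : ℝ × E → F} {U : Set E} (hU : IsOpen U) (hf : ContDiffOn ℝ ∞ f (univ ×ˢ U)) :
    ContDiffOn ℝ ∞ (fun y => ∫ t in (0 : ℝ)..1, f (t, y)) U := by
  refine contDiffOn_infty.2 fun n => ?_
  -- The derivative is an integral of the same kind with values in `E →L[ℝ] F`, so the codomain must
  -- vary in the induction; a common universe for `E` and `F` makes this possible.
  induction n generalizing F with
  | zero =>
    exact contDiffOn_zero.2 fun y hy => ((hasFDerivAt_intervalIntegral_slice hU
      (hf.of_le (by simp)) hy).continuousAt).continuousWithinAt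
  | succ n ih =>
    have hd : ∀ y ∈ U, HasFDerivAt _ _ y := fun y hy =>
      hasFDerivAt_intervalIntegral_slice hU (hf.of_le (by simp)) hy
    push_cast
    refine (contDiffOn_succ_iff_fderiv_of_isOpen hU).2
      ⟨fun y hy => (hd y hy).differentiableAt.differentiableWithinAt, by simp, ?_⟩
    have hf' : ContDiffOn ℝ ∞ (fun z : ℝ × E =>
        (fderiv ℝ f z).comp (ContinuousLinearMap.inr ℝ ℝ E)) (univ ×ˢ U) :=
      (hf.fderiv_of_isOpen (isOpen_univ.prod hU) (by simp)).clm_comp contDiffOn_const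
    exact (ih hf').congr fun y hy => (hd y hy).fderiv

/-! ### The homotopy formula on `ℝ × U` -/

section HomotopyFormula

variable {E : Type*} [NormedAddCommGroup E] [NormedSpace ℝ E] [FiniteDimensional ℝ E]
  {U : Set E} {p : ℕ}

/-- Integration over `[0,1]` of the contraction of a form on `ℝ × E` with the unit vector of `ℝ`. -/
def fibreIntegral (β : ℝ × E → (ℝ × E) [⋀^Fin (p + 1)]→L[ℝ] ℝ) (y : E) : E [⋀^Fin p]→L[ℝ] ℝ :=
  ∫ t in (0 : ℝ)..1, contractTime E p (β (t, y))

omit [FiniteDimensional ℝ E] in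
theorem hasDerivAt_restrictSpace {β : ℝ × E → (ℝ × E) [⋀^Fin p]→L[ℝ] ℝ} {t : ℝ} {y : E}
    (hβ : DifferentiableAt ℝ β (t, y)) :
    HasDerivAt (fun t => restrictSpace E p (β (t, y)))
      (restrictSpace E p (fderiv ℝ β (t, y) (1, 0))) t := by
  have h : HasDerivAt (fun t : ℝ => (t, y)) ((1 : ℝ), (0 : E)) t :=
    (hasDerivAt_id t).prodMk (hasDerivAt_const t y)
  exact (restrictSpace E p).hasFDerivAt.comp_hasDerivAt t (hβ.hasFDerivAt.comp_hasDerivAt t h)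

-- The fundamental theorem of calculus in the time variable: it integrates the Lie derivative term
-- of Cartan's formula.
omit [FiniteDimensional ℝ E] in
theorem integral_restrictSpace (hU : IsOpen U) {β : ℝ × E → (ℝ × E) [⋀^Fin p]→L[ℝ] ℝ}
    (hβ : ContDiffOn ℝ ∞ β (univ ×ˢ U)) {y : E} (hy : y ∈ U) :
    ∫ t in (0 : ℝ)..1, restrictSpace E p (fderiv ℝ β (t, y) (1, 0)) =
      restrictSpace E p (β (1, y)) - restrictSpace E p (β (0, y)) := by
  have hUo : IsOpen ((univ : Set ℝ) ×ˢ U) := isOpen_univ.prod hU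
  refine intervalIntegral.integral_eq_sub_of_hasDerivAt
    (f := fun t => restrictSpace E p (β (t, y)))
    (fun t _ => hasDerivAt_restrictSpace
      ((hβ.contDiffAt (hUo.mem_nhds ⟨mem_univ t, hy⟩)).differentiableAt (by simp))) ?_
  have h := (hβ.continuousOn_fderiv_of_isOpen hUo (by simp)).clm_apply
    (continuousOn_const (c := ((1 : ℝ), (0 : E))))
  exact (continuous_time_slice ((restrictSpace E p).continuous.comp_continuousOn h)
    hy).intervalIntegrable _ _

omit [FiniteDimensional ℝ E] in
theorem fibreIntegral_extDeriv_zero (hU : IsOpen U) {β : ℝ × E → (ℝ × E) [⋀^Fin 0]→L[ℝ] ℝ}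
    (hβ : ContDiffOn ℝ ∞ β (univ ×ˢ U)) {y : E} (hy : y ∈ U) :
    fibreIntegral (extDeriv β) y =
      restrictSpace E 0 (β (1, y)) - restrictSpace E 0 (β (0, y)) := by
  rw [← integral_restrictSpace hU hβ hy]
  exact intervalIntegral.integral_congr fun t _ => contractTime_alternatizeUncurryFin_zero _

/-- The homotopy formula for forms on `ℝ × U`, where `U` is an open set of `E`. -/
theorem extDeriv_fibreIntegral_add (hU : IsOpen U)
    {β : ℝ × E → (ℝ × E) [⋀^Fin (p + 1)]→L[ℝ] ℝ}
    (hβ : ContDiffOn ℝ ∞ β (univ ×ˢ U)) {y : E} (hy : y ∈ U) :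
    extDeriv (fibreIntegral β) y + fibreIntegral (extDeriv β) y =
      restrictSpace E (p + 1) (β (1, y)) - restrictSpace E (p + 1) (β (0, y)) := by
  have hUo : IsOpen ((univ : Set ℝ) ×ˢ U) := isOpen_univ.prod hU
  have hcβ : ContDiffOn ℝ ∞ (fun z => contractTime E p (β z)) (univ ×ˢ U) :=
    (contractTime E p).contDiff.comp_contDiffOn hβ
  have hβ' := hβ.continuousOn_fderiv_of_isOpen hUo (by simp)
  have hder : ∀ t, (fderiv ℝ (fun z => contractTime E p (β z)) (t, y)).comp
      (ContinuousLinearMap.inr ℝ ℝ E) =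
      (contractTime E p).comp ((fderiv ℝ β (t, y)).comp (ContinuousLinearMap.inr ℝ ℝ E)) := by
    intro t
    have hd : DifferentiableAt ℝ β (t, y) :=
      (hβ.contDiffAt (hUo.mem_nhds ⟨mem_univ t, hy⟩)).differentiableAt (by simp)
    have h : fderiv ℝ (fun z => contractTime E p (β z)) (t, y) =
        (contractTime E p).comp (fderiv ℝ β (t, y)) :=
      ((contractTime E p).hasFDerivAt.comp (t, y) hd.hasFDerivAt).fderiv
    rw [h]
    rfl
  have hc1 : Continuous fun t => (contractTime E p).comp
      ((fderiv ℝ β (t, y)).comp (ContinuousLinearMap.inr ℝ ℝ E)) :=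
    continuous_time_slice (f := fun z => (contractTime E p).comp
      ((fderiv ℝ β z).comp (ContinuousLinearMap.inr ℝ ℝ E)))
      (continuousOn_const.clm_comp (hβ'.clm_comp continuousOn_const)) hy
  have hi1 : IntervalIntegrable (fun t => (contractTime E p).comp
      ((fderiv ℝ β (t, y)).comp (ContinuousLinearMap.inr ℝ ℝ E))) MeasureTheory.volume 0 1 :=
    hc1.intervalIntegrable _ _
  have hi3 : IntervalIntegrable (fun t => ContinuousAlternatingMap.alternatizeUncurryFin
      ((contractTime E p).comp ((fderiv ℝ β (t, y)).comp (ContinuousLinearMap.inr ℝ ℝ E))))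
      MeasureTheory.volume 0 1 :=
    ((ContinuousAlternatingMap.alternatizeUncurryFinCLM ℝ E ℝ).continuous.comp
      hc1).intervalIntegrable _ _
  have hc2 : Continuous fun t => restrictSpace E (p + 1) (fderiv ℝ β (t, y) (1, 0)) :=
    continuous_time_slice (f := fun z => restrictSpace E (p + 1) (fderiv ℝ β z (1, 0)))
      ((restrictSpace E (p + 1)).continuous.comp_continuousOn
        (hβ'.clm_apply continuousOn_const)) hy
  -- Differentiate under the integral sign; alternatization is continuous and linear, so it passes
  -- through the integral.
  have h1 : extDeriv (fibreIntegral β) y = ∫ t in (0 : ℝ)..1,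
      ContinuousAlternatingMap.alternatizeUncurryFin ((contractTime E p).comp
        ((fderiv ℝ β (t, y)).comp (ContinuousLinearMap.inr ℝ ℝ E))) := by
    have h := (hasFDerivAt_intervalIntegral_slice hU (hcβ.of_le (by simp)) hy).fderiv
    simp only [hder] at h
    rw [extDeriv]
    change ContinuousAlternatingMap.alternatizeUncurryFin
      (fderiv ℝ (fun y => ∫ t in (0 : ℝ)..1, contractTime E p (β (t, y))) y) = _
    rw [h]
    exact ((ContinuousAlternatingMap.alternatizeUncurryFinCLM ℝ E ℝ).intervalIntegral_comp_comm
      hi1).symm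
  -- Cartan's formula under the integral: its second term cancels `h1`, and the first is a time
  -- derivative.
  have h2 : fibreIntegral (extDeriv β) y = ∫ t in (0 : ℝ)..1,
      (restrictSpace E (p + 1) (fderiv ℝ β (t, y) (1, 0)) -
        ContinuousAlternatingMap.alternatizeUncurryFin ((contractTime E p).comp
          ((fderiv ℝ β (t, y)).comp (ContinuousLinearMap.inr ℝ ℝ E)))) :=
    intervalIntegral.integral_congr fun t _ => contractTime_alternatizeUncurryFin_succ _
  rw [h1, h2, intervalIntegral.integral_sub (hc2.intervalIntegrable _ _) hi3,
    integral_restrictSpace hU hβ hy]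
  abel

end HomotopyFormula

/-! ### Pullback of forms: smoothness and compatibility with d -/

section Pullback

variable {V : Type*} [NormedAddCommGroup V] [NormedSpace ℝ V]
  {E : Type*} [NormedAddCommGroup E] [NormedSpace ℝ E]
  {E' : Type*} [NormedAddCommGroup E'] [NormedSpace ℝ E']
  {M : Type*} [TopologicalSpace M] [ChartedSpace E M]
  {N : Type*} [TopologicalSpace N] [ChartedSpace E' N]

theorem pullback_apply (f : M → N) {p : ℕ} (α : FormField E' N p) (x : M) (v : Fin p → E) :
    evalAt (pullback f α : FormField E M p) x v =
      evalAt α (f x) fun k => tangentMapAt E E' f x (v k) := rfl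

/-- The value of a form at `x`, as a form on the model space. -/
def formAt {p : ℕ} (α : FormField E M p) (x : M) : E [⋀^Fin p]→L[ℝ] ℝ := α x

/-- The pullback of a form by a map defined on a normed space. -/
def localPullback (g : V → N) {p : ℕ} (α : FormField E' N p) : V → V [⋀^Fin p]→L[ℝ] ℝ :=
  pullback g α

theorem localPullback_apply (g : V → N) {p : ℕ} (α : FormField E' N p) (z : V) (v : Fin p → V) :
    localPullback g α z v = evalAt α (g z) fun k => tangentMapAt V E' g z (v k) := rfl

theorem formField_ext {p : ℕ} {α η : FormField E M p} (h : ∀ x v, evalAt α x v = evalAt η x v) :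
    α = η :=
  funext fun x => ContinuousAlternatingMap.ext fun v => h x v

variable [IsManifold 𝓘(ℝ, E') ∞ N] {g : V → N} {U : Set V}

theorem contDiffOn_chart_comp (hg : ContMDiffOn 𝓘(ℝ, V) 𝓘(ℝ, E') ∞ g U) (x₁ : N) :
    ContDiffOn ℝ ∞ (fun w => chartAt E' x₁ (g w)) (U ∩ g ⁻¹' (chartAt E' x₁).source) := by
  rw [← contMDiffOn_iff_contDiffOn]
  exact (contMDiffOn_chart (I := 𝓘(ℝ, E')) (x := x₁)).comp (hg.mono inter_subset_left)
    fun w hw => hw.2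

/-- The pullback of a form by a map from an open set of a normed space, in a chart. -/
theorem pullback_eq_of_mem (hU : IsOpen U) (hg : ContMDiffOn 𝓘(ℝ, V) 𝓘(ℝ, E') ∞ g U) {p : ℕ}
    (α : FormField E' N p) {x₁ : N} {w : V} (hw : w ∈ U)
    (hw' : g w ∈ (chartAt E' x₁).source) :
    localPullback g α w =
      (chartForm α x₁ (chartAt E' x₁ (g w))).compContinuousLinearMap
        (fderiv ℝ (fun w => chartAt E' x₁ (g w)) w) := by
  have : IsManifold 𝓘(ℝ, E') 1 N := IsManifold.of_le (n := ∞) (by simp)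
  have hd : ∀ v : V, fderiv ℝ (fun w => chartAt E' x₁ (g w)) w v =
      tangentMapAt E' E' (chartAt E' x₁) (g w) (tangentMapAt V E' g w v) := fun v => by
    have h := mfderiv_comp w
      ((mdifferentiable_chart (I := 𝓘(ℝ, E')) x₁).mdifferentiableAt hw')
      ((hg.contMDiffAt (hU.mem_nhds hw)).mdifferentiableAt (by simp))
    rw [mfderiv_eq_fderiv] at h
    exact congrArg (fun L : V →L[ℝ] E' => L v) h
  refine ContinuousAlternatingMap.ext fun v => ?_
  rw [ContinuousAlternatingMap.compContinuousLinearMap_apply, chartForm_apply,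
    (chartAt E' x₁).left_inv hw', localPullback_apply]
  congr 1
  funext k
  simp only [Function.comp_apply]
  rw [hd, mfderiv_chart_symm_comp hw']

theorem pullback_eventuallyEq (hU : IsOpen U) (hg : ContMDiffOn 𝓘(ℝ, V) 𝓘(ℝ, E') ∞ g U) {p : ℕ}
    (α : FormField E' N p) {z : V} (hz : z ∈ U) :
    localPullback g α =ᶠ[𝓝 z] fun w =>
      (chartForm α (g z) (chartAt E' (g z) (g w))).compContinuousLinearMap
        (fderiv ℝ (fun w => chartAt E' (g z) (g w)) w) := by
  filter_upwards [(hg.continuousOn.isOpen_inter_preimage hU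
    (chartAt E' (g z)).open_source).mem_nhds ⟨hz, mem_chart_source E' (g z)⟩] with w hw
  exact pullback_eq_of_mem hU hg α hw.1 hw.2

/-- Near `z`, the chart at `g z` turns the pullback into a smooth form on the model space composed
with the derivative of a smooth map. -/
theorem contDiffOn_pullback [FiniteDimensional ℝ V] (hU : IsOpen U)
    (hg : ContMDiffOn 𝓘(ℝ, V) 𝓘(ℝ, E') ∞ g U) {p : ℕ} {α : FormField E' N p}
    (hα : IsSmoothForm α) :
    ContDiffOn ℝ ∞ (localPullback g α) U := by
  intro z hz
  set W := U ∩ g ⁻¹' (chartAt E' (g z)).source with hW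
  have hWo : IsOpen W :=
    hg.continuousOn.isOpen_inter_preimage hU (chartAt E' (g z)).open_source
  have hc := contDiffOn_chart_comp hg (g z)
  have h : ContDiffOn ℝ ∞ (fun w =>
      (chartForm α (g z) (chartAt E' (g z) (g w))).compContinuousLinearMap
        (fderiv ℝ (fun w => chartAt E' (g z) (g w)) w)) W :=
    contDiffOn_compContinuousLinearMap
      ((hα (g z)).comp hc fun w hw => (chartAt E' (g z)).map_source hw.2)
      (hc.fderiv_of_isOpen hWo (by simp))
  exact ((h.contDiffAt (hWo.mem_nhds ⟨hz, mem_chart_source E' (g z)⟩)).congr_of_eventuallyEq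
    (pullback_eventuallyEq hU hg α hz)).contDiffWithinAt

/-- The exterior derivative commutes with the pullback to an open set of a normed space. -/
theorem extDeriv_pullback_eq (hU : IsOpen U) (hg : ContMDiffOn 𝓘(ℝ, V) 𝓘(ℝ, E') ∞ g U) {p : ℕ}
    {α : FormField E' N p} (hα : IsSmoothForm α) {z : V} (hz : z ∈ U) :
    extDeriv (localPullback g α) z =
      localPullback g (extDerivField α) z := by
  have hz' := mem_chart_source E' (g z)
  have hWo := hg.continuousOn.isOpen_inter_preimage hU (chartAt E' (g z)).open_source
  have h := extDeriv_pullback (x := z) (r := ∞) (f := fun w => chartAt E' (g z) (g w))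
    ((hα.contDiffAt (g z) ((chartAt E' (g z)).map_source hz')).differentiableAt (by simp))
    ((contDiffOn_chart_comp hg (g z)).contDiffAt (hWo.mem_nhds ⟨hz, hz'⟩)) two_le_smooth
  rw [(pullback_eventuallyEq hU hg α hz).extDeriv_eq, h,
    pullback_eq_of_mem hU hg (extDerivField α) hz hz',
    chartForm_extDerivField hα _ ((chartAt E' (g z)).map_source hz')]

omit [IsManifold 𝓘(ℝ, E') ∞ N]

variable [IsManifold 𝓘(ℝ, E) ∞ M]

theorem contMDiffOn_comp_chart_symm {f : M → N} (hf : ContMDiff 𝓘(ℝ, E) 𝓘(ℝ, E') ∞ f) (x₀ : M) :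
    ContMDiffOn 𝓘(ℝ, E) 𝓘(ℝ, E') ∞ (fun y => f ((chartAt E x₀).symm y)) (chartAt E x₀).target :=
  hf.comp_contMDiffOn (contMDiffOn_chart_symm (I := 𝓘(ℝ, E)) (x := x₀))

/-- By the chain rule. Questions about pullbacks between manifolds thus reduce to maps defined on
open sets of the model space. -/
theorem chartForm_pullback {f : M → N} (hf : ContMDiff 𝓘(ℝ, E) 𝓘(ℝ, E') ∞ f) {p : ℕ}
    (α : FormField E' N p) (x₀ : M) {y : E} (hy : y ∈ (chartAt E x₀).target) :
    chartForm (pullback f α) x₀ y =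
      localPullback (fun y => f ((chartAt E x₀).symm y)) α y := by
  have : IsManifold 𝓘(ℝ, E) 1 M := IsManifold.of_le (n := ∞) (by simp)
  have h := mfderiv_comp y (hf.mdifferentiable (by simp) ((chartAt E x₀).symm y))
    ((mdifferentiable_chart (I := 𝓘(ℝ, E)) x₀).mdifferentiableAt_symm hy)
  refine ContinuousAlternatingMap.ext fun v => ?_
  rw [chartForm_apply, pullback_apply, localPullback_apply]
  congr 1
  funext k
  exact (congrArg (fun L : E →L[ℝ] E' => L (v k)) h).symm

variable [IsManifold 𝓘(ℝ, E') ∞ N]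

theorem IsSmoothForm.pullback [FiniteDimensional ℝ E] {f : M → N}
    (hf : ContMDiff 𝓘(ℝ, E) 𝓘(ℝ, E') ∞ f) {p : ℕ} {α : FormField E' N p} (hα : IsSmoothForm α) :
    IsSmoothForm (pullback f α : FormField E M p) := fun x₀ =>
  (contDiffOn_pullback (chartAt E x₀).open_target (contMDiffOn_comp_chart_symm hf x₀) hα).congr
    fun _ hy => chartForm_pullback hf α x₀ hy

/-- The exterior derivative commutes with pullbacks. -/
theorem extDerivField_pullback [FiniteDimensional ℝ E] {f : M → N}
    (hf : ContMDiff 𝓘(ℝ, E) 𝓘(ℝ, E') ∞ f) {p : ℕ} {α : FormField E' N p} (hα : IsSmoothForm α) :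
    extDerivField (pullback f α : FormField E M p) = pullback f (extDerivField α) := by
  refine formField_ext_chart fun x => ?_
  have hx := mem_chart_target E x
  have he : chartForm (LeafwiseDeRham.pullback f α : FormField E M p) x =ᶠ[𝓝 (chartAt E x x)]
      localPullback (fun y => f ((chartAt E x).symm y)) α := by
    filter_upwards [(chartAt E x).open_target.mem_nhds hx] with y hy
    exact chartForm_pullback hf α x hy
  rw [chartForm_extDerivField (hα.pullback hf) x hx, chartForm_pullback hf _ x hx,
    ← extDeriv_pullback_eq (chartAt E x).open_target (contMDiffOn_comp_chart_symm hf x) hα hx]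
  exact he.extDeriv_eq

end Pullback

/-! ### The homotopy operator on a manifold -/

section HomotopyOperator

variable {E : Type*} [NormedAddCommGroup E] [NormedSpace ℝ E]
  {E' : Type*} [NormedAddCommGroup E'] [NormedSpace ℝ E']
  {M : Type*} [TopologicalSpace M] [ChartedSpace E M]
  {N : Type*} [TopologicalSpace N] [ChartedSpace E' N] {p : ℕ}

variable (E') in
/-- The velocity `∂Ψ_t(x)/∂t` of a family of maps. -/
def velocity (Ψ : ℝ → M → N) (t : ℝ) (x : M) : E' := tangentMapAt ℝ E' (fun s => Ψ s x) t 1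

/-- The contraction with `∂/∂t` of the pullback of `α` by `Ψ`, at `(t, x)`. -/
def homotopySlice (Ψ : ℝ → M → N) (α : FormField E' N (p + 1)) (x : M) (t : ℝ) :
    E [⋀^Fin p]→L[ℝ] ℝ :=
  ((formAt α (Ψ t x)).curryLeft
    (velocity E' Ψ t x)).compContinuousLinearMap (tangentMapAt E E' (Ψ t) x)

theorem homotopySlice_apply (Ψ : ℝ → M → N) (α : FormField E' N (p + 1)) (x : M) (t : ℝ)
    (v : Fin p → E) :
    homotopySlice Ψ α x t v = evalAt α (Ψ t x)
      (Fin.cons (velocity E' Ψ t x) fun k => tangentMapAt E E' (Ψ t) x (v k)) := rfl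

/-- The homotopy operator `α ↦ ∫₀¹ Ψ_t^* (ι_{∂Ψ/∂t} α) dt`. -/
def homotopyOperator (Ψ : ℝ → M → N) (α : FormField E' N (p + 1)) : FormField E M p :=
  fun x => (∫ t in (0 : ℝ)..1, homotopySlice Ψ α x t : E [⋀^Fin p]→L[ℝ] ℝ)

variable (E) in
/-- A family of maps, in the preferred chart at `x₀` of the source. -/
def chartFamily (Ψ : ℝ → M → N) (x₀ : M) (z : ℝ × E) : N := Ψ z.1 ((chartAt E x₀).symm z.2)

variable [IsManifold 𝓘(ℝ, E) ∞ M] {Ψ : ℝ → M → N}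

theorem contMDiffOn_chartFamily
    (hΨ : ContMDiff (𝓘(ℝ, ℝ).prod 𝓘(ℝ, E)) 𝓘(ℝ, E') ∞ fun z : ℝ × M => Ψ z.1 z.2) (x₀ : M) :
    ContMDiffOn 𝓘(ℝ, ℝ × E) 𝓘(ℝ, E') ∞ (chartFamily E Ψ x₀)
      (univ ×ˢ (chartAt E x₀).target) := by
  have h1 : ContMDiffOn 𝓘(ℝ, ℝ × E) 𝓘(ℝ, ℝ) ∞ (Prod.fst : ℝ × E → ℝ)
      (univ ×ˢ (chartAt E x₀).target) := contDiff_fst.contMDiff.contMDiffOn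
  have h2 : ContMDiffOn 𝓘(ℝ, ℝ × E) 𝓘(ℝ, E) ∞ (Prod.snd : ℝ × E → E)
      (univ ×ˢ (chartAt E x₀).target) := contDiff_snd.contMDiff.contMDiffOn
  exact hΨ.comp_contMDiffOn (h1.prodMk
    ((contMDiffOn_chart_symm (I := 𝓘(ℝ, E)) (x := x₀)).comp h2 fun z hz => hz.2))

omit [IsManifold 𝓘(ℝ, E) ∞ M] in
theorem contMDiff_time_slice
    (hΨ : ContMDiff (𝓘(ℝ, ℝ).prod 𝓘(ℝ, E)) 𝓘(ℝ, E') ∞ fun z : ℝ × M => Ψ z.1 z.2) (t : ℝ) :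
    ContMDiff 𝓘(ℝ, E) 𝓘(ℝ, E') ∞ (Ψ t) :=
  hΨ.comp (contMDiff_const.prodMk contMDiff_id)

omit [IsManifold 𝓘(ℝ, E) ∞ M] in
theorem contMDiff_space_slice
    (hΨ : ContMDiff (𝓘(ℝ, ℝ).prod 𝓘(ℝ, E)) 𝓘(ℝ, E') ∞ fun z : ℝ × M => Ψ z.1 z.2) (x : M) :
    ContMDiff 𝓘(ℝ, ℝ) 𝓘(ℝ, E') ∞ (fun t => Ψ t x) :=
  hΨ.comp (contMDiff_id.prodMk contMDiff_const)

theorem mdifferentiableAt_chartFamily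
    (hΨ : ContMDiff (𝓘(ℝ, ℝ).prod 𝓘(ℝ, E)) 𝓘(ℝ, E') ∞ fun z : ℝ × M => Ψ z.1 z.2) (x₀ : M)
    {y : E} (hy : y ∈ (chartAt E x₀).target) (t : ℝ) :
    MDifferentiableAt 𝓘(ℝ, ℝ × E) 𝓘(ℝ, E') (chartFamily E Ψ x₀) (t, y) :=
  ((contMDiffOn_chartFamily hΨ x₀).contMDiffAt
    ((isOpen_univ.prod (chartAt E x₀).open_target).mem_nhds
      ⟨mem_univ t, hy⟩)).mdifferentiableAt (by simp)

theorem tangentMapAt_chartFamily_time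
    (hΨ : ContMDiff (𝓘(ℝ, ℝ).prod 𝓘(ℝ, E)) 𝓘(ℝ, E') ∞ fun z : ℝ × M => Ψ z.1 z.2) (x₀ : M)
    {y : E} (hy : y ∈ (chartAt E x₀).target) (t : ℝ) :
    tangentMapAt (ℝ × E) E' (chartFamily E Ψ x₀) (t, y) (1, 0) =
      velocity E' Ψ t ((chartAt E x₀).symm y) := by
  have hi : HasFDerivAt (fun s : ℝ => (s, y)) (ContinuousLinearMap.inl ℝ ℝ E) t :=
    hasFDerivAt_prodMk_left t y
  have h := mfderiv_comp (f := fun s : ℝ => (s, y)) t (mdifferentiableAt_chartFamily hΨ x₀ hy t)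
    hi.differentiableAt.mdifferentiableAt
  rw [mfderiv_eq_fderiv, hi.fderiv] at h
  exact (congrArg (fun L : ℝ →L[ℝ] E' => L 1) h).symm

theorem tangentMapAt_chartFamily_space
    (hΨ : ContMDiff (𝓘(ℝ, ℝ).prod 𝓘(ℝ, E)) 𝓘(ℝ, E') ∞ fun z : ℝ × M => Ψ z.1 z.2) (x₀ : M)
    {y : E} (hy : y ∈ (chartAt E x₀).target) (t : ℝ) (v : E) :
    tangentMapAt (ℝ × E) E' (chartFamily E Ψ x₀) (t, y) (0, v) =
      tangentMapAt E E' (Ψ t) ((chartAt E x₀).symm y)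
        (tangentMapAt E E (chartAt E x₀).symm y v) := by
  have : IsManifold 𝓘(ℝ, E) 1 M := IsManifold.of_le (n := ∞) (by simp)
  have hi : HasFDerivAt (fun w : E => (t, w)) (ContinuousLinearMap.inr ℝ ℝ E) y :=
    hasFDerivAt_prodMk_right t y
  have h := mfderiv_comp (f := fun w : E => (t, w)) y (mdifferentiableAt_chartFamily hΨ x₀ hy t)
    hi.differentiableAt.mdifferentiableAt
  rw [mfderiv_eq_fderiv, hi.fderiv] at h
  have h' := mfderiv_comp y
    ((contMDiff_time_slice hΨ t).mdifferentiable (by simp) ((chartAt E x₀).symm y))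
    ((mdifferentiable_chart (I := 𝓘(ℝ, E)) x₀).mdifferentiableAt_symm hy)
  exact (congrArg (fun L : E →L[ℝ] E' => L v) h).symm.trans
    (congrArg (fun L : E →L[ℝ] E' => L v) h')

/-- The two partial derivatives of the family in a chart are the velocity and the differential of `Ψ
t` composed with that of the inverse chart. This identifies the intrinsic integrand with the one on
`ℝ × E`. -/
theorem homotopySlice_comp_chart_symm
    (hΨ : ContMDiff (𝓘(ℝ, ℝ).prod 𝓘(ℝ, E)) 𝓘(ℝ, E') ∞ fun z : ℝ × M => Ψ z.1 z.2)
    (α : FormField E' N (p + 1)) (x₀ : M) {y : E} (hy : y ∈ (chartAt E x₀).target) (t : ℝ) :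
    (homotopySlice Ψ α ((chartAt E x₀).symm y) t).compContinuousLinearMap
        (tangentMapAt E E (chartAt E x₀).symm y) =
      contractTime E p (localPullback (chartFamily E Ψ x₀) α (t, y)) := by
  refine ContinuousAlternatingMap.ext fun v => ?_
  rw [contractTime_apply, ContinuousAlternatingMap.compContinuousLinearMap_apply,
    homotopySlice_apply, localPullback_apply]
  congr 1
  funext k
  refine Fin.cases ?_ (fun k => ?_) k
  · exact (tangentMapAt_chartFamily_time hΨ x₀ hy t).symm
  · exact (tangentMapAt_chartFamily_space hΨ x₀ hy t (v k)).symm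

/-- The preceding identity solved for the slice at the centre of the chart; it makes continuity in
`t`, hence integrability, visible. -/
theorem homotopySlice_eq
    (hΨ : ContMDiff (𝓘(ℝ, ℝ).prod 𝓘(ℝ, E)) 𝓘(ℝ, E') ∞ fun z : ℝ × M => Ψ z.1 z.2)
    (α : FormField E' N (p + 1)) (x : M) (t : ℝ) :
    homotopySlice Ψ α x t = (contractTime E p (localPullback (chartFamily E Ψ x) α (t, chartAt E x x))).compContinuousLinearMap
        (tangentMapAt E E (chartAt E x) x) := by
  rw [← homotopySlice_comp_chart_symm hΨ α x (mem_chart_target E x),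
    (chartAt E x).left_inv (mem_chart_source E x)]
  refine ContinuousAlternatingMap.ext fun v => ?_
  simp only [ContinuousAlternatingMap.compContinuousLinearMap_apply]
  congr 1
  funext k
  exact (mfderiv_chart_symm_comp (mem_chart_source E x) (v k)).symm

variable [FiniteDimensional ℝ E] [IsManifold 𝓘(ℝ, E') ∞ N]

theorem contDiffOn_pullback_chartFamily
    (hΨ : ContMDiff (𝓘(ℝ, ℝ).prod 𝓘(ℝ, E)) 𝓘(ℝ, E') ∞ fun z : ℝ × M => Ψ z.1 z.2)
    {α : FormField E' N p} (hα : IsSmoothForm α) (x₀ : M) :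
    ContDiffOn ℝ ∞ (localPullback (chartFamily E Ψ x₀) α)
      (univ ×ˢ (chartAt E x₀).target) :=
  contDiffOn_pullback (isOpen_univ.prod (chartAt E x₀).open_target)
    (contMDiffOn_chartFamily hΨ x₀) hα

theorem continuous_homotopySlice
    (hΨ : ContMDiff (𝓘(ℝ, ℝ).prod 𝓘(ℝ, E)) 𝓘(ℝ, E') ∞ fun z : ℝ × M => Ψ z.1 z.2)
    {α : FormField E' N (p + 1)} (hα : IsSmoothForm α) (x : M) :
    Continuous (homotopySlice Ψ α x : ℝ → E [⋀^Fin p]→L[ℝ] ℝ) := by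
  have h := continuous_time_slice (contDiffOn_pullback_chartFamily hΨ hα x).continuousOn
    (mem_chart_target E x)
  rw [funext (homotopySlice_eq hΨ α x)]
  exact (ContinuousAlternatingMap.compContinuousLinearMapCLM
    (tangentMapAt E E (chartAt E x) x)).continuous.comp ((contractTime E p).continuous.comp h)

/-- Evaluation on vectors is continuous and linear, so it passes through the integral. A pointwise
vanishing integrand will then give a vanishing form. -/
theorem homotopyOperator_apply
    (hΨ : ContMDiff (𝓘(ℝ, ℝ).prod 𝓘(ℝ, E)) 𝓘(ℝ, E') ∞ fun z : ℝ × M => Ψ z.1 z.2)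
    {α : FormField E' N (p + 1)} (hα : IsSmoothForm α) (x : M) (v : Fin p → E) :
    evalAt (homotopyOperator Ψ α : FormField E M p) x v =
      ∫ t in (0 : ℝ)..1, homotopySlice Ψ α x t v :=
  ((ContinuousAlternatingMap.apply ℝ E ℝ v).intervalIntegral_comp_comm
    ((continuous_homotopySlice hΨ hα x).intervalIntegrable 0 1)).symm

theorem chartForm_homotopyOperator
    (hΨ : ContMDiff (𝓘(ℝ, ℝ).prod 𝓘(ℝ, E)) 𝓘(ℝ, E') ∞ fun z : ℝ × M => Ψ z.1 z.2)
    {α : FormField E' N (p + 1)} (hα : IsSmoothForm α) (x₀ : M) {y : E}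
    (hy : y ∈ (chartAt E x₀).target) :
    chartForm (homotopyOperator Ψ α) x₀ y = fibreIntegral (localPullback (chartFamily E Ψ x₀) α) y :=
  ((ContinuousAlternatingMap.compContinuousLinearMapCLM
    (tangentMapAt E E (chartAt E x₀).symm y)).intervalIntegral_comp_comm
    ((continuous_homotopySlice hΨ hα _).intervalIntegrable 0 1)).symm.trans
    (intervalIntegral.integral_congr fun t _ => homotopySlice_comp_chart_symm hΨ α x₀ hy t)

theorem IsSmoothForm.homotopyOperator
    (hΨ : ContMDiff (𝓘(ℝ, ℝ).prod 𝓘(ℝ, E)) 𝓘(ℝ, E') ∞ fun z : ℝ × M => Ψ z.1 z.2)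
    {α : FormField E' N (p + 1)} (hα : IsSmoothForm α) :
    IsSmoothForm (homotopyOperator Ψ α : FormField E M p) := fun x₀ =>
  (contDiffOn_intervalIntegral_slice (chartAt E x₀).open_target
    ((contractTime E p).contDiff.comp_contDiffOn
      (contDiffOn_pullback_chartFamily hΨ hα x₀))).congr
    fun _ hy => chartForm_homotopyOperator hΨ hα x₀ hy

omit [FiniteDimensional ℝ E] [IsManifold 𝓘(ℝ, E') ∞ N] in
theorem restrictSpace_pullback_chartFamily
    (hΨ : ContMDiff (𝓘(ℝ, ℝ).prod 𝓘(ℝ, E)) 𝓘(ℝ, E') ∞ fun z : ℝ × M => Ψ z.1 z.2)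
    (α : FormField E' N p) (x₀ : M) {y : E} (hy : y ∈ (chartAt E x₀).target) (t : ℝ) :
    restrictSpace E p (localPullback (chartFamily E Ψ x₀) α (t, y)) =
      chartForm (pullback (Ψ t) α) x₀ y := by
  refine ContinuousAlternatingMap.ext fun v => ?_
  rw [restrictSpace_apply, chartForm_apply, pullback_apply, localPullback_apply]
  congr 1
  funext k
  exact tangentMapAt_chartFamily_space hΨ x₀ hy t (v k)

/-- Since d commutes with the pullback to `ℝ × E`, K d becomes the fibre integral of an exterior
derivative, to which the formula on `ℝ × U` applies. -/
theorem chartForm_homotopyOperator_extDerivField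
    (hΨ : ContMDiff (𝓘(ℝ, ℝ).prod 𝓘(ℝ, E)) 𝓘(ℝ, E') ∞ fun z : ℝ × M => Ψ z.1 z.2)
    {α : FormField E' N p} (hα : IsSmoothForm α) (x₀ : M) {y : E}
    (hy : y ∈ (chartAt E x₀).target) :
    chartForm (homotopyOperator Ψ (extDerivField α)) x₀ y =
      fibreIntegral (extDeriv (localPullback (chartFamily E Ψ x₀) α)) y := by
  rw [chartForm_homotopyOperator hΨ hα.extDerivField x₀ hy]
  refine intervalIntegral.integral_congr fun t _ => ?_
  exact congrArg (contractTime E p) (extDeriv_pullback_eq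
    (isOpen_univ.prod (chartAt E x₀).open_target) (contMDiffOn_chartFamily hΨ x₀) hα
    ⟨mem_univ t, hy⟩).symm

/-- The homotopy formula for functions. -/
theorem homotopyOperator_extDerivField_zero
    (hΨ : ContMDiff (𝓘(ℝ, ℝ).prod 𝓘(ℝ, E)) 𝓘(ℝ, E') ∞ fun z : ℝ × M => Ψ z.1 z.2)
    {α : FormField E' N 0} (hα : IsSmoothForm α) :
    (homotopyOperator Ψ (extDerivField α) : FormField E M 0) =
      pullback (Ψ 1) α - pullback (Ψ 0) α := by
  refine formField_ext_chart fun x => ?_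
  have hx := mem_chart_target E x
  rw [chartForm_homotopyOperator_extDerivField hΨ hα x hx,
    fibreIntegral_extDeriv_zero (chartAt E x).open_target
      (contDiffOn_pullback_chartFamily hΨ hα x) hx,
    restrictSpace_pullback_chartFamily hΨ α x hx, restrictSpace_pullback_chartFamily hΨ α x hx]
  rfl

/-- The homotopy formula `d K + K d = Ψ_1^* - Ψ_0^*` in positive degrees. -/
theorem extDerivField_homotopyOperator_add
    (hΨ : ContMDiff (𝓘(ℝ, ℝ).prod 𝓘(ℝ, E)) 𝓘(ℝ, E') ∞ fun z : ℝ × M => Ψ z.1 z.2)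
    {α : FormField E' N (p + 1)} (hα : IsSmoothForm α) :
    extDerivField (homotopyOperator Ψ α : FormField E M p) +
        homotopyOperator Ψ (extDerivField α) =
      pullback (Ψ 1) α - pullback (Ψ 0) α := by
  refine formField_ext_chart fun x => ?_
  have hx := mem_chart_target E x
  have he : chartForm (homotopyOperator Ψ α : FormField E M p) x =ᶠ[𝓝 (chartAt E x x)]
      fibreIntegral (localPullback (chartFamily E Ψ x) α) := by
    filter_upwards [(chartAt E x).open_target.mem_nhds hx] with y hy
    exact chartForm_homotopyOperator hΨ hα x hy
  have h := extDeriv_fibreIntegral_add (chartAt E x).open_target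
    (contDiffOn_pullback_chartFamily hΨ hα x) hx
  rw [restrictSpace_pullback_chartFamily hΨ α x hx,
    restrictSpace_pullback_chartFamily hΨ α x hx] at h
  rw [chartForm_add, Pi.add_apply, chartForm_extDerivField (hα.homotopyOperator hΨ) x hx,
    he.extDeriv_eq, chartForm_homotopyOperator_extDerivField hΨ hα x hx, h]
  rfl

end HomotopyOperator

/-! ### Leaves as sets and their tangent vectors -/

namespace Foliation

variable {E : Type*} [NormedAddCommGroup E] [NormedSpace ℝ E]
  {M : Type*} [TopologicalSpace M] [ChartedSpace E M]
  {c : ℕ} (F : Foliation E M c)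

/-- The fibre of the distinguished submersion `s_i` over `a`. -/
def fibre (r : F.Index × EuclideanSpace ℝ (Fin c)) : Set M :=
  {x | x ∈ F.dom r.1 ∧ F.proj r.1 x = r.2}

theorem isOpen_fibre (r : F.Index × EuclideanSpace ℝ (Fin c)) :
    IsOpen[F.leafTopology] (F.fibre r) :=
  TopologicalSpace.isOpen_generateFrom_of_mem
    ⟨univ, r.1, r.2, isOpen_univ, (univ_inter _).symm⟩

theorem mem_leaf_self (q : M) : q ∈ F.leaf q :=
  @mem_connectedComponent M F.leafTopology q

/-- Each distinguished submersion is locally constant on the fibres of the other ones. -/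
theorem eventually_proj_eq {i j : F.Index} {x : M} (hi : x ∈ F.dom i) (hj : x ∈ F.dom j) :
    ∀ᶠ y in 𝓝 x, F.proj i y = F.proj i x → F.proj j y = F.proj j x := by
  obtain ⟨γ, -, heq⟩ := F.exists_transition j i x ⟨hj, hi⟩
  filter_upwards [heq] with y hy hyx
  rw [hy, heq.self_of_nhds, Function.comp_apply, Function.comp_apply, hyx]

variable [SecondCountableTopology M]

/-- The transition maps make `F.proj j` locally constant on a fibre of another submersion, and
countably many of the open pieces where it is constant suffice, by second countability. -/
theorem countable_image_fibre (r : F.Index × EuclideanSpace ℝ (Fin c)) (j : F.Index) :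
    (F.proj j '' (F.fibre r ∩ F.dom j)).Countable := by
  obtain ⟨t, hts, htc, ht⟩ := TopologicalSpace.countable_cover_nhdsWithin
    (s := F.fibre r ∩ F.dom j) (f := fun x => {y | F.proj j y = F.proj j x}) fun x hx => by
      filter_upwards [self_mem_nhdsWithin,
        mem_nhdsWithin_of_mem_nhds (F.eventually_proj_eq hx.1.1 hx.2)] with y hy hyx
      exact hyx (hy.1.2.trans hx.1.2.symm)
  refine (htc.image (F.proj j)).mono ?_
  rintro _ ⟨y, hy, rfl⟩
  obtain ⟨x, hx, hyx⟩ := mem_iUnion₂.1 (ht hy)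
  exact ⟨x, hx, Eq.symm hyx⟩

/-- A leaf is covered by countably many fibres of the distinguished submersions. -/
theorem exists_countable_fibre_cover (q : M) :
    ∃ R : Set (F.Index × EuclideanSpace ℝ (Fin c)), R.Countable ∧
      F.leaf q ⊆ ⋃ r ∈ R, F.fibre r := by
  obtain ⟨T, hTc, hT⟩ := TopologicalSpace.isOpen_iUnion_countable F.dom F.isOpen_dom
  have hcov : ∀ x, ∃ i ∈ T, x ∈ F.dom i := fun x => by
    have hx : x ∈ ⋃ i ∈ T, F.dom i := by
      rw [hT]; exact mem_iUnion.2 (F.exists_mem_dom x)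
    obtain ⟨i, hi, hxi⟩ := mem_iUnion₂.1 hx
    exact ⟨i, hi, hxi⟩
  let step : Set (F.Index × EuclideanSpace ℝ (Fin c)) → Set (F.Index × EuclideanSpace ℝ (Fin c)) :=
    fun R => ⋃ r ∈ R, ⋃ j ∈ T, Prod.mk j '' (F.proj j '' (F.fibre r ∩ F.dom j))
  obtain ⟨i₀, -, hi₀⟩ := hcov q
  -- `R n` collects the fibres reached from the one through `q` by a chain of `n` successive
  -- intersections, with all new indices taken in the countable set `T`.
  let R : ℕ → Set (F.Index × EuclideanSpace ℝ (Fin c)) := fun n => step^[n] {(i₀, F.proj i₀ q)}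
  have hRs : ∀ n, R (n + 1) = step (R n) := fun n => Function.iterate_succ_apply' step n _
  have hRc : ∀ n, (R n).Countable := fun n => by
    induction n with
    | zero => exact countable_singleton _
    | succ n ih =>
      rw [hRs]
      exact ih.biUnion fun r _ => hTc.biUnion fun j _ => (F.countable_image_fibre r j).image _
  refine ⟨⋃ n, R n, countable_iUnion hRc, ?_⟩
  set A := ⋃ r ∈ ⋃ n, R n, F.fibre r with hA
  have hqA : q ∈ A :=
    mem_iUnion₂.2 ⟨(i₀, F.proj i₀ q), mem_iUnion.2 ⟨0, rfl⟩, hi₀, rfl⟩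
  have hopen : IsOpen[F.leafTopology] A :=
    @isOpen_biUnion _ _ F.leafTopology _ _ fun r _ => F.isOpen_fibre r
  -- A fibre with index in `T` that meets `A` is itself reached one stage later. So `A` is clopen
  -- for the leaf topology and contains the component of `q`.
  have hcompl : IsOpen[F.leafTopology] Aᶜ := by
    refine (@isOpen_iff_forall_mem_open M F.leafTopology Aᶜ).2 fun x hx => ?_
    obtain ⟨j, hj, hxj⟩ := hcov x
    refine ⟨F.fibre (j, F.proj j x), fun y hy hyA => hx ?_, F.isOpen_fibre _, hxj, rfl⟩
    obtain ⟨r, hr, hyr⟩ := mem_iUnion₂.1 hyA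
    obtain ⟨n, hn⟩ := mem_iUnion.1 hr
    refine mem_iUnion₂.2 ⟨(j, F.proj j x), mem_iUnion.2 ⟨n + 1, ?_⟩, hxj, rfl⟩
    rw [hRs]
    exact mem_iUnion₂.2 ⟨r, hn, mem_iUnion₂.2 ⟨j, hj, F.proj j x, ⟨y, ⟨hyr, hy.1⟩, hy.2⟩, rfl⟩⟩
  exact @IsClopen.connectedComponent_subset _ F.leafTopology _ _
    ⟨(@isOpen_compl_iff _ _ F.leafTopology).1 hcompl, hopen⟩ hqA

/-- A leaf meets the domain of a distinguished submersion in countably many fibres. -/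
theorem countable_image_leaf (q : M) (i : F.Index) :
    (F.proj i '' (F.leaf q ∩ F.dom i)).Countable := by
  obtain ⟨R, hRc, hR⟩ := F.exists_countable_fibre_cover q
  refine (hRc.biUnion fun r _ => F.countable_image_fibre r i).mono ?_
  rintro _ ⟨x, hx, rfl⟩
  obtain ⟨r, hr, hxr⟩ := mem_iUnion₂.1 (hR hx.1)
  exact mem_iUnion₂.2 ⟨r, hr, x, ⟨hxr, hx.2⟩, rfl⟩

/-- A differentiable curve that stays in a leaf is tangent to the foliation. -/
theorem tangentMapAt_mem_tangentSpace {q : M} {h : ℝ → M} {z : ℝ}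
    (hh : ContMDiffAt 𝓘(ℝ, ℝ) 𝓘(ℝ, E) 1 h z) (hc : ∀ᶠ w in 𝓝 z, ContinuousAt h w)
    (hl : ∀ᶠ w in 𝓝 z, h w ∈ F.leaf q) (v : ℝ) :
    tangentMapAt ℝ E h z v ∈ F.tangentSpace (h z) := by
  obtain ⟨i, hi⟩ := F.exists_mem_dom (h z)
  have hdom : ∀ᶠ w in 𝓝 z, h w ∈ F.dom i :=
    hh.continuousAt.preimage_mem_nhds ((F.isOpen_dom i).mem_nhds hi)
  obtain ⟨r, hr, hB⟩ := Metric.eventually_nhds_iff_ball.1 (hc.and (hl.and hdom))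
  have hcont : ContinuousOn (F.proj i ∘ h) (Metric.ball z r) := fun w hw =>
    (ContinuousAt.comp (((F.contMDiffOn_proj i).continuousOn).continuousAt
      ((F.isOpen_dom i).mem_nhds (hB w hw).2.2)) (hB w hw).1).continuousWithinAt
  have hsub : (F.proj i ∘ h) '' Metric.ball z r ⊆ F.proj i '' (F.leaf q ∩ F.dom i) := by
    rintro _ ⟨w, hw, rfl⟩
    exact ⟨h w, (hB w hw).2, rfl⟩
  -- A countable subset of `ℝ^c` is totally disconnected, so the connected image is a point. Only
  -- continuity for the manifold topology is needed; continuity for the leaf topology is not known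
  -- here.
  have hss := ((F.countable_image_leaf q i).mono hsub).isTotallyDisconnected _ Subset.rfl
    ((convex_ball z r).isPreconnected.image _ hcont)
  have hconst : F.proj i ∘ h =ᶠ[𝓝 z] fun _ => F.proj i (h z) := by
    filter_upwards [Metric.ball_mem_nhds z hr] with w hw
    exact hss ⟨w, hw, rfl⟩ ⟨z, Metric.mem_ball_self hr, rfl⟩
  have hd := mfderiv_comp z (F.mdifferentiableAt_proj i hi) (hh.mdifferentiableAt (by simp))
  rw [hconst.mfderiv_eq, mfderiv_const] at hd
  exact (F.mem_tangentSpace_iff hi _).2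
    (congrArg (fun L : ℝ →L[ℝ] EuclideanSpace ℝ (Fin c) => L v) hd).symm

omit [SecondCountableTopology M] in
/-- Every vector tangent to the foliation is the velocity of a curve that stays in the leaf. -/
theorem exists_curve_mem_leaf [FiniteDimensional ℝ E] [IsManifold 𝓘(ℝ, E) ∞ M] {q : M} {v : E}
    (hv : v ∈ F.tangentSpace q) :
    ∃ h : ℝ → M, h 0 = q ∧ ContMDiffAt 𝓘(ℝ, ℝ) 𝓘(ℝ, E) 1 h 0 ∧ tangentMapAt ℝ E h 0 1 = v ∧
      (∀ᶠ w in 𝓝 0, ContinuousAt h w) ∧ ∀ᶠ w in 𝓝 0, h w ∈ F.leaf q := by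
  obtain ⟨i, hi⟩ := F.exists_mem_dom q
  set e := chartAt E q with he
  have hqs : q ∈ e.source := mem_chart_source E q
  have hqt : e q ∈ e.target := mem_chart_target E q
  have hM : IsManifold 𝓘(ℝ, E) 1 M := IsManifold.of_le (n := ∞) (by simp)
  have hsymm : ContMDiffAt 𝓘(ℝ, E) 𝓘(ℝ, E) ∞ e.symm (e q) :=
    (contMDiffOn_chart_symm (I := 𝓘(ℝ, E)) (x := q)).contMDiffAt (e.open_target.mem_nhds hqt)
  have hi' : e.symm (e q) ∈ F.dom i := by rw [e.left_inv hqs]; exact hi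
  set s : E → EuclideanSpace ℝ (Fin c) := F.proj i ∘ e.symm with hsdef
  have hs : ContDiffAt ℝ ∞ s (e q) := by
    rw [← contMDiffAt_iff_contDiffAt]
    exact ((F.contMDiffOn_proj i).contMDiffAt ((F.isOpen_dom i).mem_nhds hi')).comp _ hsymm
  have hds : ∀ u : E, fderiv ℝ s (e q) (tangentMapAt E E e q u) =
      tangentMapAt E (EuclideanSpace ℝ (Fin c)) (F.proj i) q u := fun u => by
    have h := mfderiv_comp (e q) (F.mdifferentiableAt_proj i hi')
      (hsymm.mdifferentiableAt (by simp))
    rw [mfderiv_eq_fderiv] at h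
    have h' := congrArg (fun L : E →L[ℝ] EuclideanSpace ℝ (Fin c) =>
      L (tangentMapAt E E e q u)) h
    refine h'.trans ?_
    change tangentMapAt E (EuclideanSpace ℝ (Fin c)) (F.proj i) (e.symm (e q))
      (tangentMapAt E E e.symm (e q) (tangentMapAt E E e q u)) = _
    rw [mfderiv_chart_symm_comp hqs, e.left_inv hqs]
  have hsurj : Function.Surjective (fderiv ℝ s (e q)) := fun w => by
    obtain ⟨u, hu⟩ := F.surjective_mfderiv i q hi w
    exact ⟨tangentMapAt E E e q u, (hds u).trans hu⟩
  obtain ⟨g, hg0, hg, hdg, hgs⟩ := exists_fibre_param hs hsurj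
  have hker : tangentMapAt E E e q v ∈ (fderiv ℝ s (e q)).ker :=
    LinearMap.mem_ker.2 ((hds v).trans (hv i hi))
  -- The curve is the image, under the parametrization `g` of the fibre, of the line spanned by `v`
  -- read in the chart.
  let u : (fderiv ℝ s (e q)).ker := ⟨tangentMapAt E E e q v, hker⟩
  let l : ℝ →L[ℝ] (fderiv ℝ s (e q)).ker := (ContinuousLinearMap.id ℝ ℝ).smulRight u
  have hl0 : l 0 = 0 := map_zero l
  have hlt : Filter.Tendsto l (𝓝 0) (𝓝 0) := by
    have h := l.continuous.tendsto 0
    rwa [hl0] at h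
  have hgl : ContDiffAt ℝ ∞ (g ∘ l) 0 :=
    ContDiffAt.comp 0 (by rw [hl0]; exact hg) l.contDiff.contDiffAt
  have hgl0 : (g ∘ l) 0 = e q := by rw [Function.comp_apply, hl0, hg0]
  have hh : ContMDiffAt 𝓘(ℝ, ℝ) 𝓘(ℝ, E) ∞ (e.symm ∘ (g ∘ l)) 0 :=
    ContMDiffAt.comp 0 (by rw [hgl0]; exact hsymm) hgl.contMDiffAt
  have hh0 : (e.symm ∘ (g ∘ l)) 0 = q := by
    rw [Function.comp_apply, hgl0, e.left_inv hqs]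
  have hcont : ∀ᶠ w in 𝓝 0, ContinuousAt (e.symm ∘ (g ∘ l)) w := by
    have h1 : ∀ᶠ w in 𝓝 0, ContinuousAt (g ∘ l) w :=
      ((hgl.of_le (m := 1) (by simp)).eventually (by simp)).mono fun w hw => hw.continuousAt
    have h2 : ∀ᶠ w in 𝓝 0, (g ∘ l) w ∈ e.target :=
      hgl.continuousAt.preimage_mem_nhds (by rw [hgl0]; exact e.open_target.mem_nhds hqt)
    filter_upwards [h1, h2] with w hw hw'
    exact ContinuousAt.comp (e.continuousAt_symm hw') hw
  refine ⟨e.symm ∘ (g ∘ l), hh0, hh.of_le (by simp), ?_, hcont, ?_⟩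
  · have h := mfderiv_comp (g := e.symm) (f := g ∘ l) (0 : ℝ)
      (by rw [hgl0]; exact hsymm.mdifferentiableAt (by simp))
      (hgl.differentiableAt (by simp)).mdifferentiableAt
    have h1 : fderiv ℝ (g ∘ l) 0 1 = tangentMapAt E E e q v := by
      rw [fderiv_comp 0 (by rw [hl0]; exact hg.differentiableAt (by simp)) l.differentiableAt,
        l.fderiv, ContinuousLinearMap.comp_apply, hl0, hdg]
      exact one_smul ℝ (tangentMapAt E E e q v)
    rw [mfderiv_eq_fderiv] at h
    refine (congrArg (fun L : ℝ →L[ℝ] E => L 1) h).trans ?_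
    change tangentMapAt E E e.symm ((g ∘ l) 0) (fderiv ℝ (g ∘ l) 0 1) = v
    rw [h1, hgl0, mfderiv_chart_symm_comp hqs]
  · have hdom : ∀ᶠ w in 𝓝 0, (e.symm ∘ (g ∘ l)) w ∈ F.dom i :=
      hh.continuousAt.preimage_mem_nhds ((F.isOpen_dom i).mem_nhds (by rw [hh0]; exact hi))
    obtain ⟨r, hr, hB⟩ := Metric.eventually_nhds_iff_ball.1
      (hcont.and (hdom.and (hlt.eventually hgs)))
    -- The curve lies in one fibre of `F.proj i`, so every `F.proj j` is locally constant along it.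
    -- Preimages of the generating sets of the leaf topology are therefore neighbourhoods, and the
    -- curve stays in the component of `q`.
    have hcl : @ContinuousOn ℝ M _ F.leafTopology (e.symm ∘ (g ∘ l)) (Metric.ball 0 r) := by
      refine continuousOn_to_generateFrom_iff.2 fun w hw => ?_
      rintro _ ⟨V, j, a, hV, rfl⟩ ⟨hwV, hwj, rfl⟩
      have ht := (hB w hw).1.tendsto
      filter_upwards [self_mem_nhdsWithin, mem_nhdsWithin_of_mem_nhds
        (ht.eventually ((hV.eventually_mem hwV).and
          (((F.isOpen_dom j).eventually_mem hwj).and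
            (F.eventually_proj_eq (hB w hw).2.1 hwj))))] with w' hw' hw''
      exact ⟨hw''.1, hw''.2.1, hw''.2.2 ((hB w' hw').2.2.trans (hB w hw).2.2.symm)⟩
    have hpre := @IsPreconnected.image _ _ _ F.leafTopology _
      (convex_ball (0 : ℝ) r).isPreconnected _ hcl
    have hsub := @IsPreconnected.subset_connectedComponent _ F.leafTopology _ _ hpre
      ⟨0, Metric.mem_ball_self hr, hh0⟩
    filter_upwards [Metric.ball_mem_nhds (0 : ℝ) hr] with w hw
    exact hsub ⟨w, hw, rfl⟩

/-- The differential of a map that preserves a leaf preserves the tangent vectors of the leaf. -/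
theorem tangentMapAt_mem_of_mapsTo_leaf [FiniteDimensional ℝ E] [IsManifold 𝓘(ℝ, E) ∞ M]
    {f : M → M} (hf : ContMDiff 𝓘(ℝ, E) 𝓘(ℝ, E) ∞ f) {q : M}
    (hl : MapsTo f (F.leaf q) (F.leaf q)) {v : E} (hv : v ∈ F.tangentSpace q) :
    tangentMapAt E E f q v ∈ F.tangentSpace (f q) := by
  -- With `v` realized by a curve `h` in the leaf, `f ∘ h` is again a curve in that leaf, and its
  -- velocity is the image of `v`.
  obtain ⟨h, rfl, hh, rfl, hc, hm⟩ := F.exists_curve_mem_leaf hv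
  have hfh : ContMDiffAt 𝓘(ℝ, ℝ) 𝓘(ℝ, E) 1 (f ∘ h) 0 :=
    ((hf.of_le (by simp)).contMDiffAt).comp 0 hh
  have hmem := F.tangentMapAt_mem_tangentSpace hfh
    (hc.mono fun w hw => hf.continuous.continuousAt.comp hw) (hm.mono fun w hw => hl hw) 1
  have hd := mfderiv_comp (0 : ℝ) (hf.mdifferentiable (by simp) (h 0))
    (hh.mdifferentiableAt (by simp))
  have hd' : tangentMapAt ℝ E (f ∘ h) 0 1 = tangentMapAt E E f (h 0) (tangentMapAt ℝ E h 0 1) :=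
    congrArg (fun L : ℝ →L[ℝ] E => L 1) hd
  rw [hd'] at hmem
  exact hmem

/-- A family of maps that preserves a leaf has a velocity tangent to the leaf. -/
theorem velocity_mem_of_mapsTo_leaf {Ψ : ℝ → M → M}
    (hΨ : ContMDiff (𝓘(ℝ, ℝ).prod 𝓘(ℝ, E)) 𝓘(ℝ, E) ∞ fun z : ℝ × M => Ψ z.1 z.2) {q : M}
    (hl : ∀ t, MapsTo (Ψ t) (F.leaf q) (F.leaf q)) (t : ℝ) :
    velocity E Ψ t q ∈ F.tangentSpace (Ψ t q) := by
  have hs := contMDiff_space_slice hΨ q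
  exact F.tangentMapAt_mem_tangentSpace (hs.of_le (by simp)).contMDiffAt
    (Filter.Eventually.of_forall fun w => hs.continuous.continuousAt)
    (Filter.Eventually.of_forall fun w => hl w (F.mem_leaf_self q)) 1

end Foliation

namespace Foliation

open CategoryTheory

/-! ### Leafwise maps and leafwise homotopies -/

section Leafwise

variable {E E' E'' : Type*} [NormedAddCommGroup E] [NormedSpace ℝ E]
  [NormedAddCommGroup E'] [NormedSpace ℝ E'] [NormedAddCommGroup E''] [NormedSpace ℝ E'']
  {M N P : Type*} [TopologicalSpace M] [ChartedSpace E M] [TopologicalSpace N] [ChartedSpace E' N]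
  [TopologicalSpace P] [ChartedSpace E'' P]
  {c c' c'' : ℕ} {F : Foliation E M c} {G : Foliation E' N c'} {H : Foliation E'' P c''}

/-- A smooth map whose differential sends vectors tangent to `F` to vectors tangent to `G`. -/
structure IsLeafwise (F : Foliation E M c) (G : Foliation E' N c') (f : M → N) : Prop where
  contMDiff : ContMDiff 𝓘(ℝ, E) 𝓘(ℝ, E') ∞ f
  tangentMapAt_mem : ∀ (x : M) (v : E), v ∈ F.tangentSpace x →
    tangentMapAt E E' f x v ∈ G.tangentSpace (f x)

theorem IsLeafwise.id (F : Foliation E M c) : IsLeafwise F F id where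
  contMDiff := contMDiff_id
  tangentMapAt_mem x v hv := by
    rw [tangentMapAt, mfderiv_id]
    exact hv

theorem IsLeafwise.comp {g : N → P} {f : M → N} (hg : IsLeafwise G H g) (hf : IsLeafwise F G f) :
    IsLeafwise F H (g ∘ f) where
  contMDiff := hg.contMDiff.comp hf.contMDiff
  tangentMapAt_mem x v hv := by
    rw [tangentMapAt, mfderiv_comp x (hg.contMDiff.mdifferentiable (by simp) _)
      (hf.contMDiff.mdifferentiable (by simp) x)]
    exact hg.tangentMapAt_mem _ _ (hf.tangentMapAt_mem x v hv)

/-- A smooth homotopy through leafwise maps whose tracks are tangent to the leaves. -/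
structure IsLeafwiseHomotopy (F : Foliation E M c) (G : Foliation E' N c') (Ψ : ℝ → M → N) :
    Prop where
  contMDiff : ContMDiff (𝓘(ℝ, ℝ).prod 𝓘(ℝ, E)) 𝓘(ℝ, E') ∞ fun z : ℝ × M => Ψ z.1 z.2
  tangentMapAt_mem : ∀ (t : ℝ) (x : M) (v : E), v ∈ F.tangentSpace x →
    tangentMapAt E E' (Ψ t) x v ∈ G.tangentSpace (Ψ t x)
  velocity_mem : ∀ (t : ℝ) (x : M), velocity E' Ψ t x ∈ G.tangentSpace (Ψ t x)

theorem IsLeafwiseHomotopy.isLeafwise {Ψ : ℝ → M → N} (hΨ : IsLeafwiseHomotopy F G Ψ) (t : ℝ) :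
    IsLeafwise F G (Ψ t) :=
  ⟨contMDiff_time_slice hΨ.contMDiff t, hΨ.tangentMapAt_mem t⟩

/-- A transverse map is leafwise for the induced foliation. -/
theorem isLeafwise_induced {f : N → M} (hf : ContMDiff 𝓘(ℝ, E') 𝓘(ℝ, E) ∞ f)
    (hT : F.IsTransverse E' f) : IsLeafwise (F.induced f hf hT) F f where
  contMDiff := hf
  tangentMapAt_mem y v hv i hi := by
    have h := mfderiv_comp y (F.mdifferentiableAt_proj i hi) (hf.mdifferentiable (by simp) y)
    have hv' := hv i hi
    change mfderiv 𝓘(ℝ, E') (𝓡 c) (F.proj i ∘ f) y v = 0 at hv'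
    rw [h] at hv'
    exact hv'

/-- A map into the source of a transverse map is leafwise for the induced foliation as soon as its
composition with the transverse map is leafwise. -/
theorem IsLeafwise.of_comp {f : N → M} {hf : ContMDiff 𝓘(ℝ, E') 𝓘(ℝ, E) ∞ f}
    {hT : F.IsTransverse E' f} {r : P → N} (hr : ContMDiff 𝓘(ℝ, E'') 𝓘(ℝ, E') ∞ r)
    (h : IsLeafwise H F (f ∘ r)) : IsLeafwise H (F.induced f hf hT) r where
  contMDiff := hr
  tangentMapAt_mem x v hv i hi := by
    have hd := mfderiv_comp x (hf.mdifferentiable (by simp) (r x))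
      (hr.mdifferentiable (by simp) x)
    have hd' := mfderiv_comp (r x) (F.mdifferentiableAt_proj i hi)
      (hf.mdifferentiable (by simp) (r x))
    have hv' := h.tangentMapAt_mem x v hv i hi
    rw [tangentMapAt, hd] at hv'
    change mfderiv 𝓘(ℝ, E') (𝓡 c) (F.proj i ∘ f) (r x) _ = 0
    rw [hd']
    exact hv'

theorem mem_vanishingForms_iff [IsManifold 𝓘(ℝ, E) ∞ M] {p : ℕ} {α : DiffForm E M p} :
    α ∈ F.vanishingForms p ↔ ∀ (x : M) (v : Fin p → E), (∀ k, v k ∈ F.tangentSpace x) →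
      evalAt α.1 x v = 0 := Iff.rfl

end Leafwise

/-! ### Functoriality of the complex of forms along the leaves -/

section Complexes

universe u v

variable {E E' E'' : Type u} [NormedAddCommGroup E] [NormedSpace ℝ E] [FiniteDimensional ℝ E]
  [NormedAddCommGroup E'] [NormedSpace ℝ E'] [FiniteDimensional ℝ E']
  [NormedAddCommGroup E''] [NormedSpace ℝ E''] [FiniteDimensional ℝ E'']
  {M N P : Type v} [TopologicalSpace M] [ChartedSpace E M] [IsManifold 𝓘(ℝ, E) ∞ M]
  [TopologicalSpace N] [ChartedSpace E' N] [IsManifold 𝓘(ℝ, E') ∞ N]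
  [TopologicalSpace P] [ChartedSpace E'' P] [IsManifold 𝓘(ℝ, E'') ∞ P]
  {c c' c'' : ℕ} {F : Foliation E M c} {G : Foliation E' N c'} {H : Foliation E'' P c''}

/-- The pullback `f^* : Ω^p(N) → Ω^p(M)`. -/
def pullbackForm {f : M → N} (hf : ContMDiff 𝓘(ℝ, E) 𝓘(ℝ, E') ∞ f) (p : ℕ) :
    DiffForm E' N p →ₗ[ℝ] DiffForm E M p where
  toFun α := ⟨pullback f α.1, IsSmoothForm.pullback hf α.2⟩
  map_add' _ _ := rfl
  map_smul' _ _ := rfl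

omit [FiniteDimensional ℝ E'] in
theorem pullbackForm_mem (hf : IsLeafwise F G f) {p : ℕ} {α : DiffForm E' N p}
    (hα : α ∈ G.vanishingForms p) : pullbackForm hf.contMDiff p α ∈ F.vanishingForms p :=
  mem_vanishingForms_iff.2 fun x v hv =>
    mem_vanishingForms_iff.1 hα (f x) _ fun k => hf.tangentMapAt_mem x (v k) (hv k)

/-- The map `f^* : Ω^p(G) → Ω^p(F)`. -/
def leafPullback {f : M → N} (hf : IsLeafwise F G f) (p : ℕ) : G.LeafForm p →ₗ[ℝ] F.LeafForm p :=
  Submodule.mapQ _ _ (pullbackForm hf.contMDiff p) fun _ h => pullbackForm_mem hf h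

theorem leafPullback_leafD {f : M → N} (hf : IsLeafwise F G f) (p : ℕ) :
    F.leafD p ∘ₗ leafPullback hf p = leafPullback hf (p + 1) ∘ₗ G.leafD p := by
  ext α
  exact congrArg Submodule.Quotient.mk
    (Subtype.ext (extDerivField_pullback hf.contMDiff α.2) :
      DiffForm.d p (pullbackForm hf.contMDiff p α) =
        pullbackForm hf.contMDiff (p + 1) (DiffForm.d p α))

/-- The differential of the complex of forms along the leaves. -/
def leafDHom (F : Foliation E M c) (p : ℕ) : F.leafComplex.X p ⟶ F.leafComplex.X (p + 1) :=
  ModuleCat.ofHom (F.leafD p)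

theorem leafComplex_d (F : Foliation E M c) (p : ℕ) :
    F.leafComplex.d p (p + 1) = F.leafDHom p :=
  CochainComplex.of_d (fun p => ModuleCat.of ℝ (F.LeafForm p))
    (fun p => ModuleCat.ofHom (F.leafD p)) p

/-- The morphism of complexes induced by a leafwise map. -/
def complexPullback {f : M → N} (hf : IsLeafwise F G f) : G.leafComplex ⟶ F.leafComplex :=
  CochainComplex.ofHom (fun p => ModuleCat.ofHom (leafPullback hf p)) fun p => by
    rw [leafComplex_d, leafComplex_d]
    exact congrArg ModuleCat.ofHom (leafPullback_leafD hf p)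

theorem complexPullback_id (F : Foliation E M c) :
    complexPullback (IsLeafwise.id F) = 𝟙 F.leafComplex := by
  ext p : 1
  refine congrArg ModuleCat.ofHom (LinearMap.ext fun a => ?_ :
    leafPullback (IsLeafwise.id F) p = LinearMap.id)
  obtain ⟨α, rfl⟩ := Submodule.Quotient.mk_surjective _ a
  refine congrArg Submodule.Quotient.mk (Subtype.ext (formField_ext fun x v => ?_))
  change evalAt α.1 x (fun k => tangentMapAt E E id x (v k)) = _
  simp only [tangentMapAt, mfderiv_id]
  rfl

theorem complexPullback_comp {g : N → P} {f : M → N} (hg : IsLeafwise G H g)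
    (hf : IsLeafwise F G f) :
    complexPullback (hg.comp hf) = complexPullback hg ≫ complexPullback hf := by
  ext p : 1
  refine congrArg ModuleCat.ofHom (LinearMap.ext fun a => ?_ :
    leafPullback (hg.comp hf) p = leafPullback hf p ∘ₗ leafPullback hg p)
  obtain ⟨α, rfl⟩ := Submodule.Quotient.mk_surjective _ a
  refine congrArg Submodule.Quotient.mk (Subtype.ext (formField_ext fun x v => ?_))
  change evalAt α.1 (g (f x)) (fun k => tangentMapAt E E'' (g ∘ f) x (v k)) =
    evalAt α.1 (g (f x)) (fun k => tangentMapAt E' E'' g (f x) (tangentMapAt E E' f x (v k)))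
  congr 1
  funext k
  rw [tangentMapAt, mfderiv_comp x (hg.contMDiff.mdifferentiable (by simp) _)
    (hf.contMDiff.mdifferentiable (by simp) x)]
  rfl

/-! ### Homotopy invariance of the cohomology along the leaves -/

/-- The homotopy operator on smooth forms. -/
def homotopyForm {Ψ : ℝ → M → N} (hΨ : IsLeafwiseHomotopy F G Ψ) (p : ℕ) :
    DiffForm E' N (p + 1) →ₗ[ℝ] DiffForm E M p where
  toFun α := ⟨homotopyOperator Ψ α.1, IsSmoothForm.homotopyOperator hΨ.contMDiff α.2⟩
  map_add' α η := Subtype.ext (funext fun x => intervalIntegral.integral_add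
    ((continuous_homotopySlice hΨ.contMDiff α.2 x).intervalIntegrable 0 1)
    ((continuous_homotopySlice hΨ.contMDiff η.2 x).intervalIntegrable 0 1))
  map_smul' a α := Subtype.ext (funext fun x =>
    intervalIntegral.integral_smul a (homotopySlice Ψ α.1 x))

-- The integrand evaluates the form on the velocity and on images of vectors tangent to `F`. All of
-- these are tangent to `G`, so it vanishes for every `t`.
omit [FiniteDimensional ℝ E'] in
theorem homotopyForm_mem {Ψ : ℝ → M → N} (hΨ : IsLeafwiseHomotopy F G Ψ) {p : ℕ}
    {α : DiffForm E' N (p + 1)} (hα : α ∈ G.vanishingForms (p + 1)) :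
    homotopyForm hΨ p α ∈ F.vanishingForms p := by
  refine mem_vanishingForms_iff.2 fun x v hv => ?_
  have h0 : ∀ t, homotopySlice Ψ α.1 x t v = 0 := fun t => by
    rw [homotopySlice_apply]
    refine mem_vanishingForms_iff.1 hα (Ψ t x) _ (Fin.cases ?_ fun k => ?_)
    · exact hΨ.velocity_mem t x
    · exact hΨ.tangentMapAt_mem t x (v k) (hv k)
  refine (homotopyOperator_apply hΨ.contMDiff α.2 x v).trans ?_
  simp only [h0, intervalIntegral.integral_zero]

/-- The homotopy operator on forms along the leaves. -/
def leafHomotopy {Ψ : ℝ → M → N} (hΨ : IsLeafwiseHomotopy F G Ψ) (p : ℕ) :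
    G.LeafForm (p + 1) →ₗ[ℝ] F.LeafForm p :=
  Submodule.mapQ _ _ (homotopyForm hΨ p) fun _ h => homotopyForm_mem hΨ h

theorem leafHomotopy_leafD_zero {Ψ : ℝ → M → N} (hΨ : IsLeafwiseHomotopy F G Ψ) :
    leafHomotopy hΨ 0 ∘ₗ G.leafD 0 =
      leafPullback (hΨ.isLeafwise 1) 0 - leafPullback (hΨ.isLeafwise 0) 0 := by
  ext α
  exact congrArg Submodule.Quotient.mk
    (Subtype.ext (homotopyOperator_extDerivField_zero hΨ.contMDiff α.2) :
      homotopyForm hΨ 0 (DiffForm.d 0 α) =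
        pullbackForm (hΨ.isLeafwise 1).contMDiff 0 α - pullbackForm (hΨ.isLeafwise 0).contMDiff 0 α)

theorem leafD_leafHomotopy_add {Ψ : ℝ → M → N} (hΨ : IsLeafwiseHomotopy F G Ψ) (p : ℕ) :
    F.leafD p ∘ₗ leafHomotopy hΨ p + leafHomotopy hΨ (p + 1) ∘ₗ G.leafD (p + 1) =
      leafPullback (hΨ.isLeafwise 1) (p + 1) - leafPullback (hΨ.isLeafwise 0) (p + 1) := by
  ext α
  exact congrArg Submodule.Quotient.mk
    (Subtype.ext (extDerivField_homotopyOperator_add hΨ.contMDiff α.2) :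
      DiffForm.d p (homotopyForm hΨ p α) + homotopyForm hΨ (p + 1) (DiffForm.d (p + 1) α) =
        pullbackForm (hΨ.isLeafwise 1).contMDiff (p + 1) α -
          pullbackForm (hΨ.isLeafwise 0).contMDiff (p + 1) α)

/-- The homotopy operator, as a morphism between terms of the complexes. -/
def leafHomotopyHom {Ψ : ℝ → M → N} (hΨ : IsLeafwiseHomotopy F G Ψ) (p : ℕ) :
    G.leafComplex.X (p + 1) ⟶ F.leafComplex.X p :=
  ModuleCat.ofHom (leafHomotopy hΨ p)

/-- The components of the chain homotopy given by the homotopy operator. -/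
def homotopyHom {Ψ : ℝ → M → N} (hΨ : IsLeafwiseHomotopy F G Ψ) (i j : ℕ)
    (h : (ComplexShape.up ℕ).Rel j i) : G.leafComplex.X i ⟶ F.leafComplex.X j :=
  eqToHom (congrArg G.leafComplex.X h.symm) ≫ leafHomotopyHom hΨ j

/-- When the source degree is literally `p + 1`, the transport in the definition is an identity. -/
theorem homotopyHom_succ {Ψ : ℝ → M → N} (hΨ : IsLeafwiseHomotopy F G Ψ) (p : ℕ) :
    homotopyHom hΨ (p + 1) p rfl = leafHomotopyHom hΨ p :=
  Category.id_comp _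

/-- The homotopy formula as an equality of morphisms of complexes. Degree 0 is separate because no
differential arrives there and the term d K is missing. -/
theorem nullHomotopicMap_homotopyHom {Ψ : ℝ → M → N} (hΨ : IsLeafwiseHomotopy F G Ψ) :
    Homotopy.nullHomotopicMap' (homotopyHom hΨ) =
      complexPullback (hΨ.isLeafwise 1) - complexPullback (hΨ.isLeafwise 0) := by
  ext p : 1
  cases p with
  | zero =>
    rw [Homotopy.nullHomotopicMap'_f_of_not_rel_right (k₀ := 0 + 1) (k₁ := 0) rfl (by simp),
      leafComplex_d, homotopyHom_succ]
    exact congrArg ModuleCat.ofHom (leafHomotopy_leafD_zero hΨ)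
  | succ p =>
    rw [Homotopy.nullHomotopicMap'_f (k₂ := p) (k₁ := p + 1) (k₀ := p + 1 + 1) rfl rfl,
      leafComplex_d, leafComplex_d, homotopyHom_succ, homotopyHom_succ]
    exact (add_comm _ _).trans (congrArg ModuleCat.ofHom (leafD_leafHomotopy_add hΨ p))

/-- The ends of a leafwise homotopy induce the same map in cohomology. -/
theorem homologyMap_eq_of_isLeafwiseHomotopy {Ψ : ℝ → M → N} (hΨ : IsLeafwiseHomotopy F G Ψ)
    (p : ℕ) :
    HomologicalComplex.homologyMap (complexPullback (hΨ.isLeafwise 0)) p =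
      HomologicalComplex.homologyMap (complexPullback (hΨ.isLeafwise 1)) p :=
  (Homotopy.homologyMap_eq (Homotopy.equivSubZero.symm
    ((Homotopy.ofEq (nullHomotopicMap_homotopyHom hΨ).symm).trans
      (Homotopy.nullHomotopy' (homotopyHom hΨ)))) p).symm

/-! ### From the piecewise smooth family to an equality in cohomology -/

variable (F) in
/-- Two leafwise maps with the same effect on `H^p`. -/
def SameCohomologyMap (p : ℕ) (f g : M → M) : Prop :=
  ∃ (hf : IsLeafwise F F f) (hg : IsLeafwise F F g),
    HomologicalComplex.homologyMap (complexPullback hf) p =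
      HomologicalComplex.homologyMap (complexPullback hg) p

/-- The two proofs that `g` is leafwise may differ, but proof irrelevance makes the two middle
pullbacks the same. -/
theorem SameCohomologyMap.trans {p : ℕ} {f g h : M → M} (hfg : F.SameCohomologyMap p f g)
    (hgh : F.SameCohomologyMap p g h) : F.SameCohomologyMap p f h := by
  obtain ⟨hf, _, h₁⟩ := hfg
  obtain ⟨_, hh, h₂⟩ := hgh
  exact ⟨hf, hh, h₁.trans h₂⟩

/-- The passage from preserving leaves as sets to the infinitesimal conditions that the homotopy
operator requires. -/
theorem isLeafwiseHomotopy_of_mapsTo_leaf [SecondCountableTopology M] {Ψ : ℝ → M → M}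
    (hΨ : ContMDiff (𝓘(ℝ, ℝ).prod 𝓘(ℝ, E)) 𝓘(ℝ, E) ∞ fun z : ℝ × M => Ψ z.1 z.2)
    (hl : ∀ t q, MapsTo (Ψ t) (F.leaf q) (F.leaf q)) : IsLeafwiseHomotopy F F Ψ where
  contMDiff := hΨ
  tangentMapAt_mem t x _ hv :=
    F.tangentMapAt_mem_of_mapsTo_leaf (contMDiff_time_slice hΨ t) (hl t x) hv
  velocity_mem t x := F.velocity_mem_of_mapsTo_leaf hΨ (fun t => hl t x) t

/-- A homotopy along the leaves that is smooth on `[a, b] × M`. -/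
theorem sameCohomologyMap_of_contMDiffOn [SecondCountableTopology M] {Φ : ℝ → M → M} {a b : ℝ}
    (hab : a ≤ b)
    (hΦ : ContMDiffOn (𝓘(ℝ, ℝ).prod 𝓘(ℝ, E)) 𝓘(ℝ, E) ∞ (fun z : ℝ × M => Φ z.1 z.2)
      (Icc a b ×ˢ univ))
    (hl : ∀ t ∈ Icc a b, ∀ q, MapsTo (Φ t) (F.leaf q) (F.leaf q)) (p : ℕ) :
    F.SameCohomologyMap p (Φ a) (Φ b) := by
  -- `σ` is smooth from `ℝ` into `[a, b]` with `σ 0 = a` and `σ 1 = b`. The reparametrized family is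
  -- smooth for all real times, which removes the boundary of the interval.
  let σ : ℝ → ℝ := fun t => a + Real.smoothTransition t * (b - a)
  have hσ : ContDiff ℝ ∞ σ :=
    contDiff_const.add (Real.smoothTransition.contDiff.mul contDiff_const)
  have hσm : ∀ t, σ t ∈ Icc a b := fun t => by
    have h0 := Real.smoothTransition.nonneg t
    have h1 := Real.smoothTransition.le_one t
    constructor
    · nlinarith
    · nlinarith
  have hσ0 : σ 0 = a := by simp [σ]
  have hσ1 : σ 1 = b := by simp [σ]
  have hΨ : ContMDiff (𝓘(ℝ, ℝ).prod 𝓘(ℝ, E)) 𝓘(ℝ, E) ∞ fun z : ℝ × M => Φ (σ z.1) z.2 :=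
    contMDiffOn_univ.1 (hΦ.comp (((hσ.contMDiff.comp contMDiff_fst).prodMk
      contMDiff_snd).contMDiffOn (s := univ)) fun z _ => ⟨hσm z.1, mem_univ _⟩)
  have hH : IsLeafwiseHomotopy F F fun t => Φ (σ t) :=
    isLeafwiseHomotopy_of_mapsTo_leaf hΨ fun t q => hl _ (hσm t) q
  have h : F.SameCohomologyMap p (Φ (σ 0)) (Φ (σ 1)) :=
    ⟨hH.isLeafwise 0, hH.isLeafwise 1, homologyMap_eq_of_isLeafwiseHomotopy hH p⟩
  rwa [hσ0, hσ1] at h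

theorem sameCohomologyMap_of_isPiecewiseSmoothFamily [SecondCountableTopology M]
    {Φ : ℝ → M → M} (hΦ : IsPiecewiseSmoothFamily E Φ)
    (hl : ∀ t ∈ Icc (0 : ℝ) 1, ∀ q, MapsTo (Φ t) (F.leaf q) (F.leaf q)) (p : ℕ) :
    F.SameCohomologyMap p (Φ 0) (Φ 1) := by
  obtain ⟨m, t, ht0, htm, ht⟩ := hΦ
  -- Monotonicity places each subinterval inside `[0, 1]`, where leaf preservation is known.
  have hmono : ∀ j k, j ≤ k → k ≤ m → t j ≤ t k := fun j k hjk => by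
    induction k, hjk using Nat.le_induction with
    | base => exact fun _ => le_rfl
    | succ k _ ih => exact fun hk => (ih (by omega)).trans (ht k (by omega)).1.le
  have hpiece : ∀ k < m, F.SameCohomologyMap p (Φ (t k)) (Φ (t (k + 1))) := fun k hk =>
    sameCohomologyMap_of_contMDiffOn (ht k hk).1.le (ht k hk).2
      (fun s hs => hl s ⟨ht0 ▸ (hmono 0 k (by omega) hk.le).trans hs.1,
        htm ▸ hs.2.trans (hmono (k + 1) m hk le_rfl)⟩) p
  have hall : ∀ k < m, F.SameCohomologyMap p (Φ (t 0)) (Φ (t (k + 1))) := fun k => by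
    induction k with
    | zero => exact hpiece 0
    | succ k ih => exact fun hk => (ih (by omega)).trans (hpiece (k + 1) hk)
  cases m with
  | zero => rw [ht0] at htm; exact absurd htm zero_ne_one
  | succ m =>
    have h := hall m (by omega)
    rwa [ht0, htm] at h

end Complexes

end Foliation
end LeafwiseDeRham
end

/-! ### The isomorphism induced by restriction to `S` -/

theorem mainTheorem3 {n m c : ℕ} {Q : Type*} [TopologicalSpace Q] [T2Space Q]
    [SecondCountableTopology Q] [ChartedSpace (EuclideanSpace ℝ (Fin n)) Q]
    [IsManifold (𝓡 n) ∞ Q]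
    (F : LeafwiseDeRham.Foliation (EuclideanSpace ℝ (Fin n)) Q c)
    (S : Set Q) [ChartedSpace (EuclideanSpace ℝ (Fin m)) S] [IsManifold (𝓡 m) ∞ S]
    (hS : Manifold.IsSmoothEmbedding (𝓡 m) (𝓡 n) ∞ (Subtype.val : S → Q))
    (hT : F.IsTransverse (EuclideanSpace ℝ (Fin m)) (Subtype.val : S → Q))
    (hC : F.IsContractibleAlong S) (p : ℕ) :
    Nonempty (F.cohomology p ≃ₗ[ℝ]
      (F.induced (Subtype.val : S → Q) hS.contMDiff hT).cohomology p) := by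
  open LeafwiseDeRham LeafwiseDeRham.Foliation CategoryTheory in
  obtain ⟨Φ, hΦ, hΦ1, hΦ0, hΦS, hl⟩ := hC
  obtain ⟨h0, h1, heq⟩ := sameCohomologyMap_of_isPiecewiseSmoothFamily hΦ hl p
  let r : Q → S := fun q => ⟨Φ 0 q, hΦ0 q⟩
  -- A continuous map into `S` is smooth when its composite with the immersion `S → Q` is; here that
  -- composite is `Φ 0`.
  have hrs : ContMDiff (𝓡 n) (𝓡 m) ∞ r :=
    (ContMDiff.iff_comp_isImmersion hS.isImmersion).2
      ⟨h0.contMDiff.continuous.subtype_mk _, h0.contMDiff⟩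
  have hi := isLeafwise_induced hS.contMDiff hT
  have hr : IsLeafwise F (F.induced (Subtype.val : S → Q) hS.contMDiff hT) r :=
    IsLeafwise.of_comp hrs h0
  have hri : r ∘ Subtype.val = id := funext fun x => Subtype.ext (hΦS x x.2)
  have hΦid : Φ 1 = id := funext hΦ1
  -- The maps to be compared with the identity are equal to `id` only propositionally, so the
  -- equality has to be substituted before `complexPullback_id` applies.
  have hcast : ∀ {f : S → S} (hf : IsLeafwise (F.induced (Subtype.val : S → Q) hS.contMDiff hT)
      (F.induced (Subtype.val : S → Q) hS.contMDiff hT) f), f = id → complexPullback hf = 𝟙 _ := by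
    rintro _ hf rfl
    exact complexPullback_id _
  have hcast' : ∀ {f : Q → Q} (hf : IsLeafwise F F f), f = id → complexPullback hf = 𝟙 _ := by
    rintro _ hf rfl
    exact complexPullback_id _
  have e : F.leafComplex.homology p ≅
      (F.induced (Subtype.val : S → Q) hS.contMDiff hT).leafComplex.homology p :=
    { hom := HomologicalComplex.homologyMap (complexPullback hi) p
      inv := HomologicalComplex.homologyMap (complexPullback hr) p
      hom_inv_id := by
        rw [← HomologicalComplex.homologyMap_comp, ← complexPullback_comp]
        -- The composite is pullback by `Subtype.val ∘ r`, which is `Φ 0` by definition; in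
        -- cohomology it agrees with pullback by `Φ 1`.
        refine heq.trans ?_
        rw [hcast' h1 hΦid, HomologicalComplex.homologyMap_id]
      inv_hom_id := by
        rw [← HomologicalComplex.homologyMap_comp, ← complexPullback_comp, hcast _ hri,
          HomologicalComplex.homologyMap_id] }
  exact ⟨e.toLinearEquiv⟩
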